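/- Corollary 3 (Zolotarev polynomial). Let $n\ge 2$ be an integer and let $\sigma>\tan^2\frac{\pi}{2n}$ be real. Let $Z_n$ be the corresponding Zolotarev polynomial, i.e. a polynomial of the form $x^n-n\sigma x^{n-1}+a_{n-2}x^{n-2}+\dots+a_1x+a_0$ with $a_0,\dots,a_{n-2}\in\mathbb C$ for which $\max_{x\in[-1,1]}|Z_n(x)|$ is minimal among all polynomials of this form, and let $L_n=\max_{x\in[-1,1]}|Z_n(x)|$. Then there are real numbers $1<\alpha<\beta$ such that $$\{z\in\mathbb C: Z_n(z)\in[-L_n,L_n]\}=[-1,1]\cup[\alpha,\beta],$$ and these endpoints $\alpha,\beta$ satisfy the two polynomial equations stated below. Notation. For a sequence $s_1,s_2,\dots$ let $F_0=1$, let $F_k=0$ for $k<0$, and for $k\ge1$ let $$F_k=\frac{(-1)^k}{k!}\det\begin{pmatrix}s_1&1&0&\cdots&0\\ s_2&s_1&2&\cdots&0\\ \vdots&\vdots&\vdots&\ddots&\vdots\\ s_{k-1}&s_{k-2}&s_{k-3}&\cdots&k-1\\ s_k&s_{k-1}&s_{k-2}&\cdots&s_1\end{pmatrix}.$$ For integers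 $\nu$ and $\mu\ge0$ let $\mathcal F=(F_{\nu+r-i})_{r,i=1}^{\mu}$, and for $1\le i\le\mu$ let $\mathcal F_i$ be $\mathcal F$ with its $i$-th column replaced by $(-F_{\nu+1},\dots,-F_{\nu+\mu})^{T}$. For $\mu=0$ put $\det\mathcal F=1$ and $\det\mathcal F_1=0$. (i) If $n=2m+1$, then $$\beta^{m+1}\det\mathcal F+\beta^{m}\det\mathcal F_1+\dots+\beta\det\mathcal F_m+\det\mathcal F_{m+1}=0,$$ where $\nu=m-1$, $\mu=m+1$, $s_k=\frac12(-\alpha^k-1-(-1)^k-\beta^k)$; and $$-2\det\mathcal F_1+(\alpha-n\sigma)\det\mathcal F=0,$$ where $\nu=m+1$, $\mu=m-1$, $s_k=\frac12(\alpha^k+1+(-1)^k+\beta^k)$. (ii) If $n=2m+2$, then $$\alpha^{m+1}\det\mathcal F+\alpha^{m}\det\mathcal F_1+\dots+\alpha\det\mathcal F_m+\det\mathcal F_{m+1}=0,$$ where $\nu=m$, $\mu=m+1$, $s_k=\frac12(-\alpha^k+1-(-1)^k-\beta^k)$; and $$-2\det\mathcal F_1+(\alpha+1-n\sigma)\det\mathcal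 F=0,$$ where $\nu=m+1$, $\mu=m$, $s_k=\frac12(\alpha^k+1+(-1)^k-\beta^k)$. -/

import Mathlib

namespace ZolotarevArcs

noncomputable section

/-- The maximum of `|Q(x)|` over the real interval `[-1,1]` (it is attained). -/
def maxAbs (Q : Polynomial ℂ) : ℝ :=
  sSup ((fun x : ℝ => ‖Q.eval (x : ℂ)‖) '' Set.Icc (-1 : ℝ) 1)

/-- The competing polynomials `x ^ n - n σ x ^ (n - 1) + a_{n-2} x ^ (n - 2) + ⋯ + a_1 x + a_0`
with complex `a_0, …, a_{n-2}`. -/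
def competitors (n : ℕ) (σ : ℝ) : Set (Polynomial ℂ) :=
  {Q | ∃ R : Polynomial ℂ, R.degree < ((n - 1 : ℕ) : WithBot ℕ) ∧
    Q = Polynomial.X ^ n - Polynomial.C ((n : ℂ) * (σ : ℂ)) * Polynomial.X ^ (n - 1) + R}

/-- `Z` is a Zolotarev polynomial of degree `n` for the parameter `σ`: a competitor whose
maximum modulus on `[-1,1]` is minimal. -/
def IsZolotarev (n : ℕ) (σ : ℝ) (Z : Polynomial ℂ) : Prop :=
  Z ∈ competitors n σ ∧ ∀ Q ∈ competitors n σ, maxAbs Z ≤ maxAbs Q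

/-- The inverse image in `ℂ` of the real interval `[-L,L]` under `Z`,
where `L` is the maximum of `|Z|` on `[-1,1]`. -/
def inverseImage (Z : Polynomial ℂ) : Set ℂ :=
  {z | ∃ t : ℝ, t ∈ Set.Icc (-maxAbs Z) (maxAbs Z) ∧ Z.eval z = (t : ℂ)}

/-- The `k × k` matrix with `s_1` on the diagonal, `s_2, s_3, …` on the successive
subdiagonals, `1, 2, …, k - 1` on the superdiagonal, and zeros elsewhere. -/
def newtonMatrix (s : ℕ → ℝ) (k : ℕ) : Matrix (Fin k) (Fin k) ℝ :=
  Matrix.of fun i j =>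
    if (j : ℕ) ≤ (i : ℕ) then s ((i : ℕ) - (j : ℕ) + 1)
    else if (j : ℕ) = (i : ℕ) + 1 then ((i : ℕ) : ℝ) + 1
    else 0

/-- `F_k = ((-1) ^ k / k!) det (newtonMatrix s k)` for `k ≥ 0` (so `F_0 = 1`), and `F_k = 0` for
negative `k`. -/
def F (s : ℕ → ℝ) : ℤ → ℝ
  | Int.ofNat k => (-1) ^ k / (Nat.factorial k : ℝ) * (newtonMatrix s k).det
  | Int.negSucc _ => 0

/-- The `μ × μ` matrix whose entry in row `r` and column `i` is `F_{ν + r - i}`. -/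
def matF (s : ℕ → ℝ) (ν : ℤ) (μ : ℕ) : Matrix (Fin μ) (Fin μ) ℝ :=
  Matrix.of fun r i => F s (ν + ((r : ℕ) : ℤ) - ((i : ℕ) : ℤ))

/-- The determinant of `matF`; it is `1` for `μ = 0`. -/
def detF (s : ℕ → ℝ) (ν : ℤ) (μ : ℕ) : ℝ := (matF s ν μ).det

/-- For `1 ≤ i ≤ μ`, the determinant of `matF` with its `i`-th column (counted from `1`) replaced
by `(-F_{ν+1}, …, -F_{ν+μ})`. For other `i`, in particular for `i = 1` and
`μ = 0`, there is no such column and the value is set to `0`, so that `det F_1 / det F` is minus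
the sum of an empty family of zeros when `μ = 0`. -/
def detFi (s : ℕ → ℝ) (ν : ℤ) (μ : ℕ) (i : ℕ) : ℝ :=
  if h : 1 ≤ i ∧ i ≤ μ then
    ((matF s ν μ).updateCol ⟨i - 1, by omega⟩
      (fun r => -F s (ν + ((r : ℕ) : ℤ) + 1))).det
  else 0

/-- `v ^ μ det F + v ^ (μ - 1) det F_1 + ⋯ + v det F_{μ-1} + det F_μ`. -/
def detPoly (s : ℕ → ℝ) (ν : ℤ) (μ : ℕ) (v : ℝ) : ℝ :=
  v ^ μ * detF s ν μ + ∑ i ∈ Finset.Icc 1 μ, v ^ (μ - i) * detFi s ν μ i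

/-- `s_k = (-α ^ k - 1 - (-1) ^ k - β ^ k) / 2`. -/
def sOdd₁ (α β : ℝ) (k : ℕ) : ℝ := (-α ^ k - 1 - (-1) ^ k - β ^ k) / 2

/-- `s_k = (α ^ k + 1 + (-1) ^ k + β ^ k) / 2`. -/
def sOdd₂ (α β : ℝ) (k : ℕ) : ℝ := (α ^ k + 1 + (-1) ^ k + β ^ k) / 2

/-- `s_k = (-α ^ k + 1 - (-1) ^ k - β ^ k) / 2`. -/
def sEven₁ (α β : ℝ) (k : ℕ) : ℝ := (-α ^ k + 1 - (-1) ^ k - β ^ k) / 2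

/-- `s_k = (α ^ k + 1 + (-1) ^ k - β ^ k) / 2`. -/
def sEven₂ (α β : ℝ) (k : ℕ) : ℝ := (α ^ k + 1 + (-1) ^ k - β ^ k) / 2

end

end ZolotarevArcs

/-! ### The numbers `F` and Newton's recursion -/

namespace ZolotarevArcs

open Finset Matrix

/-! The extremal polynomial `P` is real and takes the values `±L` alternately at `n` points of
`[-1,1]` (`IsZolotarev.exists_real_alternation`). The bound on `σ` excludes a Chebyshev polynomial
stretched to an interval `[-1,γ]`, and this forces `1` and `-1` to be alternation points, with `P(1)
= -L` and `P'(1) < 0` (`alternation_endpoints`). The other `n - 2` points are critical, hence double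
zeros of `P - L` or `P + L`. To the right of `1` the polynomial drops below `-L`, returns to `-L` at
`α` and reaches `L` at `β`. By degree, `P² - L²` has no zeros other than these double points and the
simple zeros `1`, `-1`, `α`, `β`. Each value strictly between `-L` and `L` is taken at `n` real
points, one in each gap between alternation points and one in `(α,β)`. This gives the inverse image.

Subtracting the factorizations of `P - L` and `P + L` gives a Pell-type identity; for even `n` it
reads `(x - β)(x + 1)U² + 2L = (x - 1)(x - α)V²`. Reversing coefficients turns `2L` into `2L xⁿ`, so
quotients of the reversed factors are Padé approximants at `0` to square roots of rational functions
`∏(1 - ax) / ∏(1 - bx)`. By the logarithmic derivative, the numbers `F_k` are the Taylor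
coefficients of such a root when `2 s_k` is the corresponding difference of power sums
(`newtonSeries_sq_mul`). The denominator coefficients solve the Toeplitz system with matrix `matF`,
and Cramer's rule in the form `det F_i = det F * coefficient` needs no invertibility. The first
equation says that `α` (or `β`) is a zero of the denominator; the second compares coefficients of
`x^(n-1)` in `P + L`. -/

theorem det_updateCol_mulVec {n R : Type*} [Fintype n] [DecidableEq n] [CommRing R]
    (A : Matrix n n R) (v : n → R) (i : n) :
    (A.updateCol i (A *ᵥ v)).det = A.det * v i := by
  rw [← Matrix.cramer_apply, Matrix.cramer_eq_adjugate_mulVec, Matrix.mulVec_mulVec,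
    Matrix.adjugate_mul, Matrix.smul_mulVec, Matrix.one_mulVec]
  simp

/-- The sequence given by `f 0 = 1` and `k f k = -(s 1 f (k - 1) + ⋯ + s k f 0)`. -/
noncomputable def newtonSeq (s : ℕ → ℝ) : ℕ → ℝ
  | 0 => 1
  | k + 1 => -(∑ i : Fin (k + 1), s (k - i + 1) * newtonSeq s i) / (k + 1)

theorem newtonSeq_zero (s : ℕ → ℝ) : newtonSeq s 0 = 1 := by
  rw [newtonSeq]

theorem newtonSeq_succ (s : ℕ → ℝ) (k : ℕ) :
    ((k : ℝ) + 1) * newtonSeq s (k + 1) = -∑ i ∈ range (k + 1), s (k - i + 1) * newtonSeq s i := by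
  rw [newtonSeq, Finset.sum_range]
  field_simp

/-- Each row is one instance of the recursion, closed by its superdiagonal entry; only the last row
has no such entry. -/
theorem newtonMatrix_mulVec (s : ℕ → ℝ) (m : ℕ) :
    newtonMatrix s (m + 1) *ᵥ (fun j => newtonSeq s j) =
      Pi.single (Fin.last m) (-((m + 1) * newtonSeq s (m + 1))) := by
  ext i
  have key : (newtonMatrix s (m + 1) *ᵥ (fun j => newtonSeq s j)) i =
      ∑ j ∈ range (m + 1), (if j ≤ (i : ℕ) then s (i - j + 1) * newtonSeq s j
        else if j = (i : ℕ) + 1 then ((i : ℝ) + 1) * newtonSeq s j else 0) := by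
    rw [Finset.sum_range]
    simp only [newtonMatrix, Matrix.mulVec, dotProduct, Matrix.of_apply]
    refine Finset.sum_congr rfl fun j _ => ?_
    split_ifs <;> simp
  rw [key]
  obtain ⟨i, hi⟩ := i
  simp only
  have hsplit : range (i + 1) ⊆ range (m + 1) := by
    intro x; simp only [mem_range]; omega
  have h1 : ∑ j ∈ range (i + 1), (if j ≤ i then s (i - j + 1) * newtonSeq s j
        else if j = i + 1 then ((i : ℝ) + 1) * newtonSeq s j else 0) =
      -((i + 1) * newtonSeq s (i + 1)) := by
    rw [newtonSeq_succ, neg_neg]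
    refine Finset.sum_congr rfl fun j hj => ?_
    rw [if_pos (by simp only [mem_range] at hj; omega)]
  rcases Nat.lt_or_ge i m with him | him
  · rw [Pi.single_eq_of_ne (by simp [Fin.ext_iff]; omega)]
    have hsplit : range (i + 2) ⊆ range (m + 1) := by
      intro x; simp only [mem_range]; omega
    rw [← Finset.sum_subset hsplit, Finset.sum_range_succ, h1]
    · simp
    · intro x _ hx
      simp only [mem_range] at hx
      rw [if_neg (by omega), if_neg (by omega)]
  · obtain rfl : i = m := by omega
    rw [h1]
    exact (Pi.single_eq_same (M := fun _ : Fin (i + 1) => ℝ) _ _).symm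

/-- As `newtonSeq s 0 = 1`, replacing column `0` by the matrix times `newtonSeq s` preserves the
determinant. The new column has a single entry, at the bottom, and the complementary minor is lower
triangular with diagonal `1, …, m`. -/
theorem det_newtonMatrix (s : ℕ → ℝ) (k : ℕ) :
    (newtonMatrix s k).det = (-1) ^ k * (k.factorial : ℝ) * newtonSeq s k := by
  cases k with
  | zero => simp [newtonSeq_zero]
  | succ m =>
    have h := det_updateCol_mulVec (newtonMatrix s (m + 1)) (fun j => newtonSeq s j) 0
    simp only [Fin.val_zero, newtonSeq_zero, mul_one] at h
    rw [← h, newtonMatrix_mulVec, Matrix.det_succ_column_zero,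
      Finset.sum_eq_single (Fin.last m)]
    · have hsub : (((newtonMatrix s (m + 1)).updateCol 0
          (Pi.single (Fin.last m) (-((m + 1) * newtonSeq s (m + 1))))).submatrix
            (Fin.last m).succAbove Fin.succ).det = (m.factorial : ℝ) := by
        rw [Matrix.det_of_isLowerTriangular]
        · rw [← Finset.prod_range_add_one_eq_factorial, Finset.prod_range, Nat.cast_prod]
          refine Finset.prod_congr rfl fun i _ => ?_
          simp [newtonMatrix]
        · intro i j hij
          have hij' : (i : ℕ) < j := by simpa using hij
          simp only [newtonMatrix, Matrix.submatrix_apply, Fin.succAbove_last,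
            Matrix.updateCol_apply, Fin.succ_ne_zero, if_false, Matrix.of_apply, Fin.val_succ,
            Fin.val_castSucc]
          rw [if_neg (by omega), if_neg (by omega)]
      rw [hsub]
      simp only [Matrix.updateCol_self, Pi.single_eq_same, Fin.val_last, Nat.factorial_succ]
      push_cast
      ring
    · intro i _ hi
      simp [Pi.single_eq_of_ne hi]
    · simp

theorem F_natCast (s : ℕ → ℝ) (k : ℕ) : F s (k : ℤ) = newtonSeq s k := by
  change (-1) ^ k / (Nat.factorial k : ℝ) * (newtonMatrix s k).det = _
  rw [det_newtonMatrix]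
  have h : ((-1 : ℝ) ^ k) * (-1) ^ k = 1 := by rw [← mul_pow]; simp
  have : (k.factorial : ℝ) ≠ 0 := by positivity
  field_simp
  linear_combination newtonSeq s k * h

theorem F_of_neg (s : ℕ → ℝ) {k : ℤ} (hk : k < 0) : F s k = 0 := by
  obtain ⟨j, rfl⟩ := Int.eq_negSucc_of_lt_zero hk
  rfl

/-! ### The generating series of `F` -/

/-- The generating series of `newtonSeq s`. -/
noncomputable def newtonSeries (s : ℕ → ℝ) : PowerSeries ℝ := PowerSeries.mk (newtonSeq s)

theorem derivative_newtonSeries (s : ℕ → ℝ) :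
    PowerSeries.derivative ℝ (newtonSeries s) =
      -(PowerSeries.mk fun k => s (k + 1)) * newtonSeries s := by
  ext k
  rw [PowerSeries.coeff_derivative, newtonSeries, PowerSeries.coeff_mk, mul_comm, newtonSeq_succ,
    neg_mul, map_neg, mul_comm (PowerSeries.mk _), PowerSeries.coeff_mul,
    Finset.Nat.sum_antidiagonal_eq_sum_range_succ_mk]
  simp [mul_comm]

theorem mk_pow_mul (a : ℝ) :
    (PowerSeries.mk fun k => a ^ (k + 1)) * (1 - PowerSeries.C a * PowerSeries.X) =
      PowerSeries.C a := by
  ext k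
  rw [mul_sub, mul_one, mul_left_comm, map_sub, PowerSeries.coeff_C_mul]
  cases k with
  | zero => simp
  | succ k => rw [PowerSeries.coeff_succ_mul_X]; simp [pow_succ]; ring

/-- The power series `∏ (1 - a X)` over the entries `a` of a list. -/
noncomputable def linProd (l : List ℝ) : PowerSeries ℝ :=
  (l.map fun a => 1 - PowerSeries.C a * PowerSeries.X).prod

theorem linProd_nil : linProd [] = 1 := rfl

theorem linProd_cons (a : ℝ) (l : List ℝ) :
    linProd (a :: l) = (1 - PowerSeries.C a * PowerSeries.X) * linProd l := by
  simp [linProd]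

theorem constantCoeff_linProd (l : List ℝ) : PowerSeries.constantCoeff (linProd l) = 1 := by
  induction l with
  | nil => simp [linProd_nil]
  | cons a l ih => rw [linProd_cons, map_mul, ih]; simp

theorem derivative_linProd (l : List ℝ) :
    PowerSeries.derivative ℝ (linProd l) =
      -(PowerSeries.mk fun k => (l.map fun a => a ^ (k + 1)).sum) * linProd l := by
  induction l with
  | nil =>
    have : (PowerSeries.mk fun _ : ℕ => (0 : ℝ)) = 0 := by ext; simp
    simp [linProd_nil, this]
  | cons a l ih =>
    have hsum : (PowerSeries.mk fun k => ((a :: l).map fun a => a ^ (k + 1)).sum) =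
        (PowerSeries.mk fun k => a ^ (k + 1)) +
          PowerSeries.mk fun k => (l.map fun a => a ^ (k + 1)).sum := by
      ext; simp
    rw [linProd_cons, hsum, Derivation.leibniz, ih]
    have hd : PowerSeries.derivative ℝ (1 - PowerSeries.C a * PowerSeries.X) =
        -PowerSeries.C a := by
      simp [Derivation.leibniz]
    rw [hd]
    simp only [smul_eq_mul]
    linear_combination linProd l * mk_pow_mul a

/-- Uniqueness for a linear differential equation: `y z⁻¹` has derivative `0` and constant term `1`.
-/
theorem eq_of_derivative_eq_mul {y z T : PowerSeries ℝ}
    (hy : PowerSeries.derivative ℝ y = T * y) (hz : PowerSeries.derivative ℝ z = T * z)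
    (hy0 : PowerSeries.constantCoeff y = 1) (hz0 : PowerSeries.constantCoeff z = 1) : y = z := by
  have hzz : z * z⁻¹ = 1 := PowerSeries.mul_inv_cancel z (by simp [hz0])
  have h1 : y * z⁻¹ = 1 := by
    apply PowerSeries.derivative.ext
    · rw [Derivation.leibniz, PowerSeries.derivative_inv', hy, hz, PowerSeries.derivative_one]
      simp only [smul_eq_mul]
      linear_combination (-(y * T * z⁻¹)) * hzz
    · simp [hy0, hz0]
  calc y = y * (z * z⁻¹) := by rw [hzz, mul_one]
    _ = (y * z⁻¹) * z := by ring
    _ = z := by rw [h1, one_mul]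

/-- If `2 s_k` is the difference of the power sums of `N` and of `D`, then the generating series
is the square root of `∏_N (1 - a X) / ∏_D (1 - a X)`. -/
theorem newtonSeries_sq_mul (s : ℕ → ℝ) (N D : List ℝ)
    (hs : ∀ k, 2 * s k = (N.map fun a => a ^ k).sum - (D.map fun a => a ^ k).sum) :
    newtonSeries s ^ 2 * linProd D = linProd N := by
  have hT : (PowerSeries.mk fun k => (N.map fun a => a ^ (k + 1)).sum) =
      2 * (PowerSeries.mk fun k => s (k + 1)) +
        PowerSeries.mk fun k => (D.map fun a => a ^ (k + 1)).sum := by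
    ext k
    rw [two_mul]
    simp only [map_add, PowerSeries.coeff_mk]
    linarith [hs (k + 1)]
  refine eq_of_derivative_eq_mul ?_ (derivative_linProd N) ?_ (constantCoeff_linProd N)
  · rw [hT, Derivation.leibniz, Derivation.leibniz_pow, derivative_linProd,
      derivative_newtonSeries]
    simp only [smul_eq_mul, nsmul_eq_mul]
    push_cast
    ring
  · rw [map_mul, constantCoeff_linProd, map_pow]
    simp [newtonSeries, ← PowerSeries.coeff_zero_eq_constantCoeff_apply, newtonSeq_zero]

end ZolotarevArcs

/-! ### Padé approximants and the determinant identities -/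

namespace ZolotarevArcs

open Finset Matrix

/-- The coefficients of orders `ν + 1, …, ν + μ` lie beyond the degree of `Q`, so those of the
product with `P` vanish; isolating the term of `P.coeff 0 = 1` leaves the linear system. -/
theorem matF_mulVec_of_dvd (s : ℕ → ℝ) (ν μ : ℕ) (P Q : Polynomial ℝ)
    (hP : P.natDegree ≤ μ) (hP0 : P.coeff 0 = 1) (hQ : Q.natDegree ≤ ν)
    (h : PowerSeries.X ^ (ν + μ + 1) ∣ newtonSeries s * (P : PowerSeries ℝ) - (Q : PowerSeries ℝ)) :
    matF s ν μ *ᵥ (fun i => P.coeff ((i : ℕ) + 1)) =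
      fun r : Fin μ => -F s ((ν : ℤ) + ((r : ℕ) : ℤ) + 1) := by
  ext r
  obtain ⟨r, hr⟩ := r
  have h0 := (PowerSeries.X_pow_dvd_iff.mp h) (ν + r + 1) (by omega)
  rw [map_sub, Polynomial.coeff_coe, Polynomial.coeff_eq_zero_of_natDegree_lt (p := Q) (by omega),
    sub_zero, mul_comm, PowerSeries.coeff_mul, Finset.Nat.sum_antidiagonal_eq_sum_range_succ_mk,
    Finset.sum_range_succ'] at h0
  simp only [Polynomial.coeff_coe, newtonSeries, PowerSeries.coeff_mk, hP0, one_mul] at h0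
  -- Both sums are padded to a common range: here `F` vanishes at negative indices, in `h2` the
  -- coefficients of `P` vanish beyond its degree.
  have h1 : ∑ i ∈ range (ν + r + 1), P.coeff (i + 1) * newtonSeq s (ν + r + 1 - (i + 1)) =
      ∑ i ∈ range (ν + r + 1 + μ), F s ((ν : ℤ) + (r : ℤ) - (i : ℤ)) * P.coeff (i + 1) := by
    rw [← Finset.sum_subset (s₁ := range (ν + r + 1)) (s₂ := range (ν + r + 1 + μ))]
    · refine Finset.sum_congr rfl fun i hi => ?_
      rw [mem_range] at hi
      have : (ν : ℤ) + (r : ℤ) - (i : ℤ) = ((ν + r + 1 - (i + 1) : ℕ) : ℤ) := by omega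
      rw [this, F_natCast, mul_comm]
    · intro i; simp only [mem_range]; omega
    · intro i _ hi
      rw [mem_range] at hi
      rw [F_of_neg _ (by omega), zero_mul]
  have h2 : ∑ i ∈ range μ, F s ((ν : ℤ) + (r : ℤ) - (i : ℤ)) * P.coeff (i + 1) =
      ∑ i ∈ range (ν + r + 1 + μ), F s ((ν : ℤ) + (r : ℤ) - (i : ℤ)) * P.coeff (i + 1) := by
    refine Finset.sum_subset ?_ ?_
    · intro i; simp only [mem_range]; omega
    · intro i _ hi
      rw [mem_range] at hi
      rw [Polynomial.coeff_eq_zero_of_natDegree_lt (by omega), mul_zero]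
  have h3 : ((ν : ℤ) + (r : ℤ) + 1) = ((ν + r + 1 : ℕ) : ℤ) := by push_cast; ring
  simp only [Matrix.mulVec, dotProduct, matF, Matrix.of_apply]
  rw [h3, F_natCast, ← Finset.sum_range (fun i => F s ((ν : ℤ) + (r : ℤ) - (i : ℤ)) *
    P.coeff (i + 1)), h2, ← h1]
  simp only [Nat.sub_zero] at h0
  linarith

/-- The difference of squares factors as `(G W - V) * (D (G W + V))`, and the second factor has
constant term `2`, hence is a unit. -/
theorem X_pow_dvd_mul_sub_of_sq {G W V D N : PowerSeries ℝ} {k : ℕ} (hG : G ^ 2 * D = N)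
    (hWV : PowerSeries.X ^ k ∣ W ^ 2 * N - V ^ 2 * D)
    (hG0 : PowerSeries.constantCoeff G = 1) (hW0 : PowerSeries.constantCoeff W = 1)
    (hV0 : PowerSeries.constantCoeff V = 1) (hD0 : PowerSeries.constantCoeff D = 1) :
    PowerSeries.X ^ k ∣ G * W - V := by
  have hu : IsUnit (D * (G * W + V)) := by
    rw [PowerSeries.isUnit_iff_constantCoeff]
    simp [hG0, hW0, hV0, hD0]
  have : W ^ 2 * N - V ^ 2 * D = (G * W - V) * (D * (G * W + V)) := by
    rw [← hG]; ring
  rw [this] at hWV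
  exact (hu.dvd_mul_right).mp hWV

theorem constantCoeff_newtonSeries (s : ℕ → ℝ) :
    PowerSeries.constantCoeff (newtonSeries s) = 1 := by
  rw [← PowerSeries.coeff_zero_eq_constantCoeff_apply, newtonSeries, PowerSeries.coeff_mk,
    newtonSeq_zero]

theorem constantCoeff_reverse {P : Polynomial ℝ} (hP : P.Monic) :
    PowerSeries.constantCoeff (P.reverse : PowerSeries ℝ) = 1 := by
  rw [← PowerSeries.coeff_zero_eq_constantCoeff_apply, Polynomial.coeff_coe,
    Polynomial.coeff_zero_reverse, hP.leadingCoeff]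

/-- The determinants `detFi` are `detF` times the coefficients of the denominator of a Padé
approximant of the square root of `∏_N (1 - a X) / ∏_D (1 - a X)`. -/
theorem detFi_eq_of_pade (s : ℕ → ℝ) (N D : List ℝ)
    (hs : ∀ k, 2 * s k = (N.map fun a => a ^ k).sum - (D.map fun a => a ^ k).sum)
    (ν μ : ℕ) (W Q : Polynomial ℝ) (hW : W.Monic) (hWd : W.natDegree = μ) (hQ : Q.Monic)
    (hQd : Q.natDegree = ν)
    (h : PowerSeries.X ^ (ν + μ + 1) ∣ (W.reverse : PowerSeries ℝ) ^ 2 * linProd N -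
      (Q.reverse : PowerSeries ℝ) ^ 2 * linProd D) {i : ℕ} (hi : 1 ≤ i) (hiμ : i ≤ μ) :
    detFi s ν μ i = detF s ν μ * W.coeff (μ - i) := by
  have hd := X_pow_dvd_mul_sub_of_sq (newtonSeries_sq_mul s N D hs) h
    (constantCoeff_newtonSeries s) (constantCoeff_reverse hW) (constantCoeff_reverse hQ)
    (constantCoeff_linProd D)
  have hv := matF_mulVec_of_dvd s ν μ W.reverse Q.reverse
    ((Polynomial.reverse_natDegree_le W).trans hWd.le)
    (by rw [Polynomial.coeff_zero_reverse, hW.leadingCoeff])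
    ((Polynomial.reverse_natDegree_le Q).trans hQd.le) hd
  rw [detFi, dif_pos ⟨hi, hiμ⟩, ← hv, det_updateCol_mulVec, detF]
  congr 1
  simp only
  rw [Polynomial.coeff_reverse, hWd, Polynomial.revAt_le (by omega)]
  congr 1
  omega

theorem detFi_one_eq_of_pade (s : ℕ → ℝ) (N D : List ℝ)
    (hs : ∀ k, 2 * s k = (N.map fun a => a ^ k).sum - (D.map fun a => a ^ k).sum)
    (ν μ : ℕ) (W Q : Polynomial ℝ) (hW : W.Monic) (hWd : W.natDegree = μ) (hQ : Q.Monic)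
    (hQd : Q.natDegree = ν)
    (h : PowerSeries.X ^ (ν + μ + 1) ∣ (W.reverse : PowerSeries ℝ) ^ 2 * linProd N -
      (Q.reverse : PowerSeries ℝ) ^ 2 * linProd D) :
    detFi s ν μ 1 = detF s ν μ * W.nextCoeff := by
  rcases Nat.eq_zero_or_pos μ with h0 | h0
  -- For `μ = 0` both sides are `0` by convention.
  · rw [Polynomial.nextCoeff, if_pos (hWd.trans h0), detFi, dif_neg (by omega), mul_zero]
  · rw [detFi_eq_of_pade s N D hs ν μ W Q hW hWd hQ hQd h le_rfl h0, Polynomial.nextCoeff,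
      if_neg (by omega), hWd]

theorem detPoly_eq_of_pade (s : ℕ → ℝ) (N D : List ℝ)
    (hs : ∀ k, 2 * s k = (N.map fun a => a ^ k).sum - (D.map fun a => a ^ k).sum)
    (ν μ : ℕ) (W Q : Polynomial ℝ) (hW : W.Monic) (hWd : W.natDegree = μ) (hQ : Q.Monic)
    (hQd : Q.natDegree = ν)
    (h : PowerSeries.X ^ (ν + μ + 1) ∣ (W.reverse : PowerSeries ℝ) ^ 2 * linProd N -
      (Q.reverse : PowerSeries ℝ) ^ 2 * linProd D) (v : ℝ) :
    detPoly s ν μ v = detF s ν μ * W.eval v := by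
  have hIcc : Finset.Icc 1 μ = (range μ).map (addRightEmbedding 1) := by
    ext x; simp only [mem_Icc, mem_map, mem_range, addRightEmbedding_apply]
    exact ⟨fun hx => ⟨x - 1, by omega, by omega⟩, fun ⟨y, hy, hyx⟩ => by omega⟩
  have hsum : W.eval v = v ^ μ + ∑ i ∈ Finset.Icc 1 μ, v ^ (μ - i) * W.coeff (μ - i) := by
    rw [Polynomial.eval_eq_sum_range, hWd, Finset.sum_range_succ, ← hWd, hW.coeff_natDegree, hWd,
      one_mul, add_comm, ← Finset.sum_range_reflect, hIcc, Finset.sum_map]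
    congr 1
    refine Finset.sum_congr rfl fun i hi => ?_
    rw [addRightEmbedding_apply, mul_comm, show μ - 1 - i = μ - (i + 1) by omega]
  rw [hsum, detPoly, mul_add, mul_comm (detF s ν μ), Finset.mul_sum]
  congr 1
  refine Finset.sum_congr rfl fun i hi => ?_
  rw [mem_Icc] at hi
  rw [detFi_eq_of_pade s N D hs ν μ W Q hW hWd hQ hQd h hi.1 hi.2]
  ring

theorem coe_reverse_X_sub_C_mul (a : ℝ) (P : Polynomial ℝ) :
    (((Polynomial.X - Polynomial.C a) * P).reverse : PowerSeries ℝ) =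
      (1 - PowerSeries.C a * PowerSeries.X) * (P.reverse : PowerSeries ℝ) := by
  have : (Polynomial.X - Polynomial.C a).reverse = 1 - Polynomial.C a * Polynomial.X := by
    rw [Polynomial.reverse, Polynomial.natDegree_X_sub_C, Polynomial.reflect_sub,
      Polynomial.reflect_C, ← pow_one (Polynomial.X : Polynomial ℝ), Polynomial.reflect_monomial]
    simp
  rw [Polynomial.reverse_mul_of_domain, this]
  simp

theorem coe_reverse_sq (P : Polynomial ℝ) :
    ((P ^ 2).reverse : PowerSeries ℝ) = (P.reverse : PowerSeries ℝ) ^ 2 := by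
  rw [sq, Polynomial.reverse_mul_of_domain, sq]
  simp

/-- An additive constant moves to order `n`, so it is invisible to the approximation. -/
theorem coe_reverse_add_C {P Q : Polynomial ℝ} {n : ℕ} {c : ℝ} (hP : P.natDegree = n)
    (hQ : Q.natDegree = n) (h : P + Polynomial.C c = Q) :
    (P.reverse : PowerSeries ℝ) + PowerSeries.C c * PowerSeries.X ^ n =
      (Q.reverse : PowerSeries ℝ) := by
  rw [Polynomial.reverse, Polynomial.reverse, hP, hQ, ← h, Polynomial.reflect_add,
    Polynomial.reflect_C]
  simp

theorem natDegree_X_sub_C_mul (a : ℝ) {P : Polynomial ℝ} (hP : P.Monic) :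
    ((Polynomial.X - Polynomial.C a) * P).natDegree = P.natDegree + 1 := by
  rw [Polynomial.Monic.natDegree_mul (Polynomial.monic_X_sub_C a) hP, Polynomial.natDegree_X_sub_C,
    add_comm]

open Polynomial in
-- The reversed identity is multiplied by `1 - αx`, which completes the square of the reversal of
-- `(X - α)V`, and by `1 + x`, which does so for `(X + 1)U`. In both cases `ν + μ + 1 = 2m + 2` is
-- exactly the order of contact.
theorem even_determinant_identities (m : ℕ) (α β c : ℝ) (U V : ℝ[X]) (hU : U.Monic)
    (hV : V.Monic) (hUd : U.natDegree = m) (hVd : V.natDegree = m)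
    (h : (X - C β) * ((X - C (-1)) * U ^ 2) + C c = (X - C 1) * ((X - C α) * V ^ 2)) :
    detPoly (sEven₁ α β) (m : ℤ) (m + 1) α = 0 ∧
      detFi (sEven₂ α β) ((m : ℤ) + 1) m 1 = detF (sEven₂ α β) ((m : ℤ) + 1) m * V.nextCoeff := by
  have hU2 := hU.pow 2
  have hV2 := hV.pow 2
  have hE := coe_reverse_add_C (n := 2 * m + 2)
    (by rw [natDegree_X_sub_C_mul _ ((monic_X_sub_C _).mul hU2), natDegree_X_sub_C_mul _ hU2,
      hU.natDegree_pow, hUd])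
    (by rw [natDegree_X_sub_C_mul _ ((monic_X_sub_C _).mul hV2), natDegree_X_sub_C_mul _ hV2,
      hV.natDegree_pow, hVd]) h
  simp only [coe_reverse_X_sub_C_mul, coe_reverse_sq] at hE
  constructor
  · have hd : PowerSeries.X ^ (m + (m + 1) + 1) ∣
        (((X - C α) * V).reverse : PowerSeries ℝ) ^ 2 * linProd [1] -
          (U.reverse : PowerSeries ℝ) ^ 2 * linProd [α, -1, β] := by
      refine ⟨(1 - PowerSeries.C α * PowerSeries.X) * PowerSeries.C c, ?_⟩
      simp only [coe_reverse_X_sub_C_mul, linProd_cons, linProd_nil]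
      rw [show m + (m + 1) + 1 = 2 * m + 2 by ring]
      linear_combination -(1 - PowerSeries.C α * PowerSeries.X) * hE
    rw [detPoly_eq_of_pade (sEven₁ α β) [1] [α, -1, β] (fun k => by simp [sEven₁]; ring) m (m + 1)
      ((X - C α) * V) U ((monic_X_sub_C _).mul hV) (by rw [natDegree_X_sub_C_mul _ hV, hVd]) hU hUd
      hd]
    simp
  · have hd : PowerSeries.X ^ (m + 1 + m + 1) ∣
        (V.reverse : PowerSeries ℝ) ^ 2 * linProd [α, 1, -1] -
          (((X - C (-1)) * U).reverse : PowerSeries ℝ) ^ 2 * linProd [β] := by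
      refine ⟨(1 - PowerSeries.C (-1) * PowerSeries.X) * PowerSeries.C c, ?_⟩
      simp only [coe_reverse_X_sub_C_mul, linProd_cons, linProd_nil]
      rw [show m + 1 + m + 1 = 2 * m + 2 by ring]
      linear_combination -(1 - PowerSeries.C (-1) * PowerSeries.X) * hE
    have := detFi_one_eq_of_pade (sEven₂ α β) [α, 1, -1] [β] (fun k => by simp [sEven₂]; ring)
      (m + 1) m V ((X - C (-1)) * U) hV hVd ((monic_X_sub_C _).mul hU)
      (by rw [natDegree_X_sub_C_mul _ hU, hUd]) hd
    push_cast at this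
    exact this

open Polynomial in
-- Here the degree is `2m + 3`. The factor `1 - βx` serves both parts: the same pair `(X - β)U`, `V`
-- approximates a square root and its inverse, with the roles of numerator and denominator
-- exchanged.
theorem odd_determinant_identities (m : ℕ) (α β c : ℝ) (U V : ℝ[X]) (hU : U.Monic)
    (hV : V.Monic) (hUd : U.natDegree = m + 1) (hVd : V.natDegree = m)
    (h : (X - C β) * U ^ 2 + C c = (X - C 1) * ((X - C (-1)) * ((X - C α) * V ^ 2))) :
    detPoly (sOdd₁ α β) (m : ℤ) (m + 2) β = 0 ∧
      detFi (sOdd₂ α β) ((m : ℤ) + 2) m 1 = detF (sOdd₂ α β) ((m : ℤ) + 2) m * V.nextCoeff := by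
  have hU2 := hU.pow 2
  have hV2 := hV.pow 2
  have hE := coe_reverse_add_C (n := 2 * m + 3)
    (by rw [natDegree_X_sub_C_mul _ hU2, hU.natDegree_pow, hUd]; ring)
    (by rw [natDegree_X_sub_C_mul _ ((monic_X_sub_C _).mul ((monic_X_sub_C _).mul hV2)),
      natDegree_X_sub_C_mul _ ((monic_X_sub_C _).mul hV2), natDegree_X_sub_C_mul _ hV2,
      hV.natDegree_pow, hVd]) h
  simp only [coe_reverse_X_sub_C_mul, coe_reverse_sq] at hE
  have hWd : ((X - C β) * U).natDegree = m + 2 := by rw [natDegree_X_sub_C_mul _ hU, hUd]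
  constructor
  · have hd : PowerSeries.X ^ (m + (m + 2) + 1) ∣
        (((X - C β) * U).reverse : PowerSeries ℝ) ^ 2 * linProd [] -
          (V.reverse : PowerSeries ℝ) ^ 2 * linProd [α, 1, -1, β] := by
      refine ⟨-(1 - PowerSeries.C β * PowerSeries.X) * PowerSeries.C c, ?_⟩
      simp only [coe_reverse_X_sub_C_mul, linProd_cons, linProd_nil]
      rw [show m + (m + 2) + 1 = 2 * m + 3 by ring]
      linear_combination (1 - PowerSeries.C β * PowerSeries.X) * hE
    rw [detPoly_eq_of_pade (sOdd₁ α β) [] [α, 1, -1, β] (fun k => by simp [sOdd₁]; ring) m (m + 2)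
      ((X - C β) * U) V ((monic_X_sub_C _).mul hU) hWd hV hVd hd]
    simp
  · have hd : PowerSeries.X ^ (m + 2 + m + 1) ∣
        (V.reverse : PowerSeries ℝ) ^ 2 * linProd [α, 1, -1, β] -
          (((X - C β) * U).reverse : PowerSeries ℝ) ^ 2 * linProd [] := by
      refine ⟨(1 - PowerSeries.C β * PowerSeries.X) * PowerSeries.C c, ?_⟩
      simp only [coe_reverse_X_sub_C_mul, linProd_cons, linProd_nil]
      rw [show m + 2 + m + 1 = 2 * m + 3 by ring]
      linear_combination -(1 - PowerSeries.C β * PowerSeries.X) * hE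
    have := detFi_one_eq_of_pade (sOdd₂ α β) [α, 1, -1, β] [] (fun k => by simp [sOdd₂]; ring)
      (m + 2) m V ((X - C β) * U) hV hVd ((monic_X_sub_C _).mul hU) hWd hd
    push_cast at this
    exact this

end ZolotarevArcs

/-! ### Chebyshev alternation and reality of the extremal polynomial -/

namespace ZolotarevArcs

open Polynomial

theorem mul_pos_of_common {a b c : ℝ} (h₁ : 0 < a * b) (h₂ : 0 < c * b) : 0 < a * c := by
  by_contra h
  nlinarith [mul_pos h₁ h₂, mul_nonneg (neg_nonneg.mpr (not_lt.mp h)) (sq_nonneg b)]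

/-- A nonvanishing function on a finite set of reals agrees in sign with a polynomial whose degree
is at most the length minus one of some alternating sequence in the set. -/
theorem exists_sign_polynomial_and_alternation (s : ℝ → ℝ) (E : Finset ℝ) :
    E.Nonempty → (∀ x ∈ E, s x ≠ 0) →
    ∃ (k : ℕ) (q : ℝ[X]) (y : ℕ → ℝ), q.natDegree ≤ k ∧ (∀ x ∈ E, 0 < q.eval x * s x) ∧
      (∀ i ≤ k, y i ∈ E) ∧ (∀ x ∈ E, x ≤ y 0) ∧ (∀ i < k, y (i + 1) < y i) ∧
      (∀ i < k, s (y (i + 1)) * s (y i) < 0) ∧ ∀ t, y 0 ≤ t → 0 < q.eval t * s (y 0) := by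
  induction E using Finset.induction_on_max with
  | empty => intro h; simp at h
  | insert a E ha ih =>
    intro _ hs
    have hsa : s a ≠ 0 := hs a (Finset.mem_insert_self _ _)
    rcases E.eq_empty_or_nonempty with rfl | hE
    · have : 0 < s a * s a := mul_self_pos.mpr hsa
      refine ⟨0, C (s a), fun _ => a, by simp, ?_, by simp, by simp, by simp, by simp, ?_⟩
      · simpa using this
      · simpa using fun _ _ => this
    obtain ⟨k, q, y, hq, hqs, hyE, hmax, hy, hsy, hqt⟩ :=
      ih hE fun x hx => hs x (Finset.mem_insert_of_mem hx)
    have hy0 : y 0 ∈ E := hyE 0 (Nat.zero_le _)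
    have hya : y 0 < a := ha _ hy0
    have hs0 : s (y 0) ≠ 0 := hs _ (Finset.mem_insert_of_mem hy0)
    have hle : ∀ x ∈ insert a E, x ≤ a := by
      intro x hx
      rcases Finset.mem_insert.mp hx with rfl | hx
      · exact le_rfl
      · exact (ha x hx).le
    rcases lt_or_gt_of_ne (mul_ne_zero hsa hs0) with hneg | hpos
    -- A sign change: `a` is prepended and `q` gets a zero midway between `y 0` and `a`. The new
    -- factor is positive on the old points, none of which exceeds `y 0`.
    · refine ⟨k + 1, q * (C ((y 0 + a) / 2) - X), fun i => i.casesOn a y, ?_, ?_, ?_, hle, ?_, ?_,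
        ?_⟩
      · refine natDegree_mul_le.trans (add_le_add hq ?_)
        rw [← neg_sub, natDegree_neg, natDegree_X_sub_C]
      · intro x hx
        simp only [eval_mul, eval_sub, eval_C, eval_X]
        rcases Finset.mem_insert.mp hx with rfl | hx
        · have h1 := hqt x hya.le
          have h2 := mul_pos_of_common (c := -s x) h1 (by linarith)
          nlinarith [mul_pos h2 (sub_pos.mpr hya)]
        · have h1 := hqs x hx
          have h2 : 0 < (y 0 + a) / 2 - x := by linarith [hmax x hx]
          nlinarith [mul_pos h1 h2]
      · intro i hi
        cases i with
        | zero => exact Finset.mem_insert_self _ _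
        | succ i => exact Finset.mem_insert_of_mem (hyE i (by omega))
      · intro i hi
        cases i with
        | zero => exact hya
        | succ i => exact hy i (by omega)
      · intro i hi
        cases i with
        | zero => simpa [mul_comm] using hneg
        | succ i => exact hsy i (by omega)
      · intro t ht
        simp only [eval_mul, eval_sub, eval_C, eval_X]
        change a ≤ t at ht
        have h1 := hqt t (hya.le.trans ht)
        have h2 := mul_pos_of_common (c := -s a) h1 (by linarith)
        have h3 : 0 < t - (y 0 + a) / 2 := by linarith
        change 0 < _ * s a
        nlinarith [mul_pos h2 h3]
    -- No sign change: `a` replaces `y 0`, so that the first point stays the largest.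
    · have hqa : ∀ t, a ≤ t → 0 < q.eval t * s a := fun t ht =>
        mul_pos_of_common (hqt t (hya.le.trans ht)) hpos
      refine ⟨k, q, fun i => if i = 0 then a else y i, hq, ?_, ?_, by simpa using hle, ?_, ?_,
        by simpa using hqa⟩
      · intro x hx
        rcases Finset.mem_insert.mp hx with rfl | hx
        · exact hqa x le_rfl
        · exact hqs x hx
      · intro i hi
        dsimp only
        split_ifs
        · exact Finset.mem_insert_self _ _
        · exact Finset.mem_insert_of_mem (hyE i hi)
      · intro i hi
        simp only [Nat.add_eq_zero_iff, one_ne_zero, and_false, if_false]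
        split_ifs with h
        · subst h
          exact (hy 0 hi).trans hya
        · exact hy i hi
      · intro i hi
        simp only [Nat.add_eq_zero_iff, one_ne_zero, and_false, if_false]
        split_ifs with h
        · subst h
          have h1 := hsy 0 hi
          have h2 := mul_pos_of_common (a := -s (y (0 + 1))) (b := s (y 0)) (c := s a)
            (by linarith) hpos
          linarith
        · exact hsy i hi

/-- Near an extremal point `(f - εq)² = f² - ε(2qf - εq²)` with `qf > 0`; near any other point `|f|
< L` persists. Compactness makes `ε` uniform. -/
theorem exists_smaller_of_pos_on_extremal {f q : ℝ → ℝ} (hf : Continuous f) (hq : Continuous q)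
    {K : Set ℝ} (hK : IsCompact K) {L : ℝ} (hfL : ∀ x ∈ K, |f x| ≤ L)
    (hfq : ∀ x ∈ K, |f x| = L → 0 < q x * f x) :
    ∃ ε : ℝ, ∀ x ∈ K, |f x - ε * q x| < L := by
  have key : ∀ᶠ ε in nhds (0 : ℝ), ∀ x ∈ K, 0 < ε → x ∈ K → |f x - ε * q x| < L := by
    refine hK.eventually_forall_of_forall_eventually fun x hx => ?_
    rcases (hfL x hx).lt_or_eq with h | h
    · have hc : Continuous fun z : ℝ × ℝ => |f z.2 - z.1 * q z.2| := by fun_prop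
      have := hc.continuousAt.eventually_lt (x₀ := ((0 : ℝ), x)) continuousAt_const
        (by simpa using h)
      filter_upwards [this] with z hz _ _ using hz
    · have hc : Continuous fun z : ℝ × ℝ => z.1 * q z.2 ^ 2 - 2 * (q z.2 * f z.2) := by fun_prop
      have := hc.continuousAt.eventually_lt (x₀ := ((0 : ℝ), x)) (g := fun _ => (0 : ℝ))
        continuousAt_const (by simpa using hfq x hx h)
      filter_upwards [this] with z hz hε hzK
      have hL : 0 ≤ L := h ▸ abs_nonneg _
      refine abs_lt_of_sq_lt_sq ?_ hL
      have h1 : f z.2 ^ 2 ≤ L ^ 2 := sq_le_sq.mpr ((hfL _ hzK).trans (le_abs_self L))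
      nlinarith [mul_pos_of_neg_of_neg hz (neg_lt_zero.mpr hε)]
  obtain ⟨δ, hδ, h⟩ := Metric.eventually_nhds_iff.mp key
  refine ⟨δ / 2, fun x hx => h ?_ x hx (by positivity) hx⟩
  rw [Real.dist_eq, sub_zero, abs_of_pos (by positivity)]
  linarith

/-- Chebyshev alternation on `[-1, 1]`, with the points in decreasing order. -/
theorem exists_alternation {n : ℕ} (hn : 2 ≤ n) {P : ℝ[X]} (hP : P.natDegree = n) {L : ℝ}
    (hPL : ∀ x ∈ Set.Icc (-1 : ℝ) 1, |P.eval x| ≤ L)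
    (hmin : ∀ R : ℝ[X], R.degree < ((n - 1 : ℕ) : WithBot ℕ) →
      ∃ x ∈ Set.Icc (-1 : ℝ) 1, L ≤ |P.eval x - R.eval x|) :
    0 < L ∧ ∃ y : ℕ → ℝ, (∀ i < n, y i ∈ Set.Icc (-1 : ℝ) 1) ∧ (∀ i, i + 1 < n → y (i + 1) < y i) ∧
      |P.eval (y 0)| = L ∧ ∀ i < n, P.eval (y i) = (-1) ^ i * P.eval (y 0) := by
  have hP0 : P ≠ 0 := by rintro rfl; simp at hP; omega
  have hL : 0 < L := by
    by_contra hL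
    refine hP0 (eq_zero_of_infinite_isRoot P ((Set.Icc_infinite (by norm_num : (-1 : ℝ) < 1)).mono
      fun x hx => ?_))
    have := (hPL x hx).trans (not_lt.mp hL)
    simpa [IsRoot] using this
  refine ⟨hL, ?_⟩
  have hfin : {x : ℝ | x ∈ Set.Icc (-1 : ℝ) 1 ∧ |P.eval x| = L}.Finite := by
    have hne : P ^ 2 - C (L ^ 2) ≠ 0 := by
      intro h
      have := congrArg natDegree (sub_eq_zero.mp h)
      rw [natDegree_pow, natDegree_C, hP] at this
      omega
    refine (finite_setOfPred_isRoot hne).subset fun x hx => ?_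
    have h2 : P.eval x ^ 2 = L ^ 2 := by rw [← sq_abs, hx.2]
    simp [IsRoot, h2]
  have hmem : ∀ x, x ∈ hfin.toFinset ↔ x ∈ Set.Icc (-1 : ℝ) 1 ∧ |P.eval x| = L := by simp
  have hne : hfin.toFinset.Nonempty := by
    obtain ⟨x, hx, hLx⟩ := hmin 0 (by simp)
    exact ⟨x, (hmem x).mpr ⟨hx, le_antisymm (hPL x hx) (by simpa using hLx)⟩⟩
  obtain ⟨k, q, y, hq, hqs, hyE, -, hy, hsy, -⟩ :=
    exists_sign_polynomial_and_alternation (fun x => P.eval x) hfin.toFinset hne (by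
      intro x hx h0
      have := ((hmem x).mp hx).2
      rw [h0, abs_zero] at this
      exact hL.ne this)
  -- With fewer than `n` alternation points, `q` has degree below `n - 1`, and subtracting a small
  -- multiple of it contradicts minimality.
  have hk : n ≤ k + 1 := by
    by_contra hk
    obtain ⟨ε, hε⟩ := exists_smaller_of_pos_on_extremal (f := fun x => P.eval x)
      (q := fun x => q.eval x) P.continuous q.continuous isCompact_Icc hPL
      fun x hx h => hqs x ((hmem x).mpr ⟨hx, h⟩)
    obtain ⟨x, hx, hLx⟩ := hmin (C ε * q) (by
      refine degree_le_natDegree.trans_lt ?_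
      have := natDegree_C_mul_le ε q
      exact_mod_cast (by omega : (C ε * q).natDegree < n - 1))
    have := hε x hx
    rw [eval_mul, eval_C] at hLx
    linarith
  refine ⟨y, fun i hi => ((hmem _).mp (hyE i (by omega))).1, fun i hi => hy i (by omega),
    ((hmem _).mp (hyE 0 (by omega))).2, fun i => ?_⟩
  induction i with
  | zero => simp
  | succ i ih =>
    intro hi
    have h1 := ((hmem _).mp (hyE i (by omega))).2
    have h2 := ((hmem _).mp (hyE (i + 1) (by omega))).2
    have h3 := hsy i (by omega)
    have h4 : P.eval (y (i + 1)) = -P.eval (y i) := by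
      rcases abs_eq_abs.mp (h2.trans h1.symm) with h | h
      · rw [h] at h3
        nlinarith [mul_self_nonneg (P.eval (y i))]
      · exact h
    rw [h4, ih (by omega), pow_succ]
    ring

theorem exists_real_imaginary_parts (k : ℕ) (R : ℂ[X]) (hR : R.degree < (k : WithBot ℕ)) :
    ∃ A B : ℝ[X], A.degree < (k : WithBot ℕ) ∧ B.degree < (k : WithBot ℕ) ∧
      R = A.map Complex.ofRealHom + C Complex.I * B.map Complex.ofRealHom := by
  have hdeg : ∀ f : ℕ → ℝ, (∑ i ∈ Finset.range k, monomial i (f i)).degree < (k : WithBot ℕ) := by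
    intro f
    rw [degree_lt_iff_coeff_zero]
    intro j hj
    rw [finsetSum_coeff]
    refine Finset.sum_eq_zero fun i hi => ?_
    rw [coeff_monomial, if_neg]
    rw [Finset.mem_range] at hi
    omega
  refine ⟨∑ i ∈ Finset.range k, monomial i (R.coeff i).re,
    ∑ i ∈ Finset.range k, monomial i (R.coeff i).im, hdeg _, hdeg _, ?_⟩
  ext j
  rcases Nat.lt_or_ge j k with hj | hj
  · simp [coeff_monomial, finsetSum_coeff, hj]
    rw [mul_comm]
    exact (Complex.re_add_im _).symm
  · rw [degree_lt_iff_coeff_zero] at hR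
    rw [hR j hj]
    have : ¬ j < k := by omega
    simp [coeff_monomial, finsetSum_coeff, this]

theorem eval_map_ofReal (P : ℝ[X]) (x : ℝ) :
    (P.map Complex.ofRealHom).eval (x : ℂ) = ((P.eval x : ℝ) : ℂ) :=
  eval_map_apply (f := Complex.ofRealHom) (p := P) x

theorem norm_eval_le_maxAbs (Q : ℂ[X]) {x : ℝ} (hx : x ∈ Set.Icc (-1 : ℝ) 1) :
    ‖Q.eval (x : ℂ)‖ ≤ maxAbs Q := by
  have hc : Continuous fun x : ℝ => ‖Q.eval (x : ℂ)‖ := by fun_prop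
  exact le_csSup (isCompact_Icc.image hc).bddAbove (Set.mem_image_of_mem _ hx)

theorem exists_norm_eval_eq_maxAbs (Q : ℂ[X]) :
    ∃ x ∈ Set.Icc (-1 : ℝ) 1, ‖Q.eval (x : ℂ)‖ = maxAbs Q := by
  have hc : Continuous fun x : ℝ => ‖Q.eval (x : ℂ)‖ := by fun_prop
  exact (isCompact_Icc.image hc).sSup_mem ⟨_, Set.mem_image_of_mem _ (by norm_num : (0:ℝ) ∈ _)⟩

/-- A Zolotarev polynomial is real and alternates at `n` points of `[-1, 1]`. -/
theorem IsZolotarev.exists_real_alternation {n : ℕ} (hn : 2 ≤ n) {σ : ℝ} {Z : ℂ[X]}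
    (hZ : IsZolotarev n σ Z) :
    ∃ P : ℝ[X], Z = P.map Complex.ofRealHom ∧ P.Monic ∧ P.natDegree = n ∧
      P.coeff (n - 1) = -(n * σ) ∧ (∀ x ∈ Set.Icc (-1 : ℝ) 1, |P.eval x| ≤ maxAbs Z) ∧
      0 < maxAbs Z ∧
      ∃ y : ℕ → ℝ, (∀ i < n, y i ∈ Set.Icc (-1 : ℝ) 1) ∧ (∀ i, i + 1 < n → y (i + 1) < y i) ∧
      |P.eval (y 0)| = maxAbs Z ∧ ∀ i < n, P.eval (y i) = (-1) ^ i * P.eval (y 0) := by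
  obtain ⟨⟨R, hR, hZR⟩, hmin⟩ := hZ
  obtain ⟨A, B, hA, hB, hAB⟩ := exists_real_imaginary_parts (n - 1) R hR
  have hT : (-C ((n : ℝ) * σ) * X ^ (n - 1) + A).degree < (n : WithBot ℕ) := by
    refine (degree_add_le _ _).trans_lt (max_lt ?_ ?_)
    · rw [← C_neg]
      refine (degree_C_mul_X_pow_le _ _).trans_lt ?_
      exact_mod_cast (by omega : n - 1 < n)
    · refine hA.trans ?_
      exact_mod_cast (by omega : n - 1 < n)
  obtain ⟨P, hP⟩ : ∃ P, P = X ^ n + (-C ((n : ℝ) * σ) * X ^ (n - 1) + A) := ⟨_, rfl⟩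
  have hPm : P.Monic := hP ▸ monic_X_pow_add hT
  have hPd : P.natDegree = n := by
    refine natDegree_eq_of_degree_eq_some ?_
    rw [hP, degree_add_eq_left_of_degree_lt (by rwa [degree_X_pow]), degree_X_pow]
  have hPc : P.coeff (n - 1) = -(n * σ) := by
    rw [hP, ← C_neg, coeff_add, coeff_add, coeff_X_pow, if_neg (by omega), coeff_C_mul_X_pow,
      if_pos rfl, coeff_eq_zero_of_degree_lt hA]
    ring
  have hZP : Z = P.map Complex.ofRealHom + C Complex.I * B.map Complex.ofRealHom := by
    rw [hZR, hAB, hP]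
    simp only [Polynomial.map_add, Polynomial.map_mul, Polynomial.map_neg, Polynomial.map_pow,
      map_X, map_C, Complex.ofRealHom_eq_coe]
    push_cast
    ring
  have heval : ∀ x : ℝ, Z.eval (x : ℂ) = ((P.eval x : ℝ) : ℂ) + ((B.eval x : ℝ) : ℂ) * Complex.I := by
    intro x
    rw [hZP, eval_add, eval_mul, eval_C, eval_map_ofReal, eval_map_ofReal, mul_comm]
  have hsq : ∀ x ∈ Set.Icc (-1 : ℝ) 1, P.eval x ^ 2 + B.eval x ^ 2 ≤ maxAbs Z ^ 2 := by
    intro x hx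
    have h := norm_eval_le_maxAbs Z hx
    rw [heval, Complex.norm_add_mul_I] at h
    exact (Real.sqrt_le_left ((Real.sqrt_nonneg _).trans h)).mp h
  have hL0 : 0 ≤ maxAbs Z := (norm_nonneg _).trans (norm_eval_le_maxAbs Z (x := 0) (by norm_num))
  have hPL : ∀ x ∈ Set.Icc (-1 : ℝ) 1, |P.eval x| ≤ maxAbs Z := fun x hx =>
    abs_le_of_sq_le_sq (by nlinarith [hsq x hx, sq_nonneg (B.eval x)]) hL0
  obtain ⟨hL, y, hyI, hy, hy0, hya⟩ := exists_alternation hn hPd hPL (by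
    intro S hS
    have hcomp : (P - S).map Complex.ofRealHom ∈ competitors n σ := by
      refine ⟨(A - S).map Complex.ofRealHom, ?_, ?_⟩
      · exact degree_map_le.trans_lt ((degree_sub_le _ _).trans_lt (max_lt hA hS))
      · rw [hP]
        simp only [Polynomial.map_add, Polynomial.map_mul, Polynomial.map_neg, Polynomial.map_pow,
          Polynomial.map_sub, map_X, map_C, Complex.ofRealHom_eq_coe]
        push_cast
        ring
    obtain ⟨x, hx, hxe⟩ := exists_norm_eval_eq_maxAbs ((P - S).map Complex.ofRealHom)
    refine ⟨x, hx, (hmin _ hcomp).trans (hxe.symm.trans ?_).le⟩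
    rw [eval_map_ofReal, Complex.norm_real, eval_sub, Real.norm_eq_abs])
  -- At the alternation points `P² = L²` already exhausts the bound on `P² + B²`, so `B` has `n`
  -- zeros, more than its degree allows.
  have hB0 : B = 0 := by
    have hanti : StrictAntiOn y (Finset.range n : Set ℕ) := by
      rw [Finset.coe_range]
      exact strictAntiOn_of_succ_lt Set.ordConnected_Iio (fun i _ _ hi => hy i hi)
    refine eq_zero_of_degree_lt_of_eval_index_eq_zero (Finset.range n) hanti.injOn
      (hB.trans_le ?_) fun i hi => ?_
    · rw [Finset.card_range]
      exact_mod_cast Nat.sub_le n 1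
    · rw [Finset.mem_range] at hi
      have h1 := hsq (y i) (hyI i hi)
      have h2 : P.eval (y i) ^ 2 = maxAbs Z ^ 2 := by
        rw [hya i hi, mul_pow, ← pow_mul, mul_comm i, pow_mul, ← hy0, sq_abs]
        simp
      exact pow_eq_zero_iff (two_ne_zero) |>.mp (le_antisymm (by linarith) (sq_nonneg _))
  refine ⟨P, ?_, hPm, hPd, hPc, hPL, hL, y, hyI, hy, hy0, hya⟩
  rw [hZP, hB0]
  simp

end ZolotarevArcs

namespace ZolotarevArcs

open Polynomial

/-! ### Comparison with Chebyshev polynomials -/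

/-- Lagrange interpolation: for decreasing nodes, `∏ (y i - y j)` over `j ≠ i` has exactly `i`
negative factors, hence the sign `(-1)^i`. -/
theorem coeff_eq_sum_of_alternation {k : ℕ} {y : ℕ → ℝ} (hy : ∀ i < k, y (i + 1) < y i) {D : ℝ[X]}
    (hD : D.degree < ((k + 1 : ℕ) : WithBot ℕ)) :
    ∃ w : ℕ → ℝ, (∀ i ≤ k, 0 < w i) ∧
      D.coeff k = ∑ i ∈ Finset.range (k + 1), ((-1) ^ i * D.eval (y i)) * w i := by
  have hanti : StrictAntiOn y (Set.Iic k) :=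
    strictAntiOn_of_succ_lt Set.ordConnected_Iic fun i _ _ hi => hy i hi
  have hpos : ∀ i ≤ k, 0 < (-1) ^ i * ∏ j ∈ (Finset.range (k + 1)).erase i, (y i - y j) := by
    intro i hi
    have h₁ : 0 < ∏ j ∈ Finset.range i, ((-1) * (y i - y j)) :=
      Finset.prod_pos fun j hj => by
        have hj := Finset.mem_range.mp hj
        have := hanti (hj.le.trans hi) hi hj
        linarith
    rw [Finset.prod_mul_distrib, Finset.prod_const, Finset.card_range] at h₁
    have h₂ : 0 < ∏ j ∈ Finset.Ioc i k, (y i - y j) :=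
      Finset.prod_pos fun j hj => by
        have hj := Finset.mem_Ioc.mp hj
        exact sub_pos.mpr (hanti hi hj.2 hj.1)
    have union : (Finset.range (k + 1)).erase i = Finset.range i ∪ Finset.Ioc i k := by grind
    have disj : Disjoint (Finset.range i) (Finset.Ioc i k) := by grind [Finset.disjoint_iff_ne]
    rw [union, Finset.prod_union disj, ← mul_assoc]
    exact mul_pos h₁ h₂
  refine ⟨fun i => ((-1) ^ i * ∏ j ∈ (Finset.range (k + 1)).erase i, (y i - y j))⁻¹,
    fun i hi => inv_pos.mpr (hpos i hi), ?_⟩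
  have hinj : Set.InjOn y (Finset.range (k + 1) : Set ℕ) := by
    refine hanti.injOn.mono fun i hi => ?_
    have := Finset.mem_range.mp (Finset.mem_coe.mp hi)
    exact Nat.lt_succ_iff.mp this
  have h := Lagrange.coeff_eq_sum hinj (P := D) (by rwa [Finset.card_range])
  rw [Finset.card_range, Nat.add_sub_cancel] at h
  rw [h]
  refine Finset.sum_congr rfl fun i _ => ?_
  dsimp only
  rw [mul_inv, div_eq_mul_inv]
  have : ((-1 : ℝ) ^ i) * ((-1) ^ i)⁻¹ = 1 := mul_inv_cancel₀ (by simp)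
  linear_combination (-D.eval (y i) * (∏ j ∈ (Finset.range (k + 1)).erase i, (y i - y j))⁻¹) * this

theorem coeff_nonneg_of_alternation {k : ℕ} {y : ℕ → ℝ} (hy : ∀ i < k, y (i + 1) < y i) {D : ℝ[X]}
    (hD : D.degree < ((k + 1 : ℕ) : WithBot ℕ)) (h : ∀ i ≤ k, 0 ≤ (-1) ^ i * D.eval (y i)) :
    0 ≤ D.coeff k := by
  obtain ⟨w, hw, hsum⟩ := coeff_eq_sum_of_alternation hy hD
  rw [hsum]
  refine Finset.sum_nonneg fun i hi => ?_
  have hi := Nat.lt_succ_iff.mp (Finset.mem_range.mp hi)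
  exact mul_nonneg (h i hi) (hw i hi).le

theorem coeff_pos_of_alternation {k : ℕ} {y : ℕ → ℝ} (hy : ∀ i < k, y (i + 1) < y i) {D : ℝ[X]}
    (hD : D.degree < ((k + 1 : ℕ) : WithBot ℕ)) (h : ∀ i ≤ k, 0 < (-1) ^ i * D.eval (y i)) :
    0 < D.coeff k := by
  obtain ⟨w, hw, hsum⟩ := coeff_eq_sum_of_alternation hy hD
  rw [hsum]
  refine Finset.sum_pos (fun i hi => ?_) ⟨0, by simp⟩
  have hi := Nat.lt_succ_iff.mp (Finset.mem_range.mp hi)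
  exact mul_pos (h i hi) (hw i hi)

theorem one_le_two_pow_mul_of_monic {n : ℕ} {P : ℝ[X]} (hP : P.Monic) (hPd : P.natDegree = n)
    {L : ℝ} (hL : 0 < L) (hPL : ∀ x ∈ Set.Icc (-1 : ℝ) 1, |P.eval x| ≤ L) :
    1 ≤ 2 ^ (n - 1) * L := by
  have h := Chebyshev.coeff_le_of_forall_abs_le_one (n := n) (P := C L⁻¹ * P)
    (degree_le_of_natDegree_le ((natDegree_C_mul_le _ _).trans hPd.le)) (by
      intro x hx
      rw [eval_mul, eval_C, abs_mul, abs_of_pos (inv_pos.mpr hL)]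
      exact inv_mul_le_one_of_le₀ (hPL x hx) hL.le)
  rw [coeff_C_mul, ← hPd, hP.coeff_natDegree, hPd, mul_one] at h
  rwa [← inv_le_iff_one_le_mul₀ hL]

theorem coeff_T_natCast (n : ℕ) : (Chebyshev.T ℝ n).coeff n = 2 ^ (n - 1) := by
  have h := Chebyshev.leadingCoeff_T ℝ (n : ℤ)
  rw [leadingCoeff, Chebyshev.natDegree_T] at h
  simpa using h

/-- `T_n` has the parity of `n`. -/
theorem coeff_T_pred {n : ℕ} (hn : 1 ≤ n) : (Chebyshev.T ℝ n).coeff (n - 1) = 0 := by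
  have h : (Chebyshev.T ℝ n).comp (C (-1) * X) = C ((-1) ^ n) * Chebyshev.T ℝ n := by
    refine funext fun x => ?_
    rw [eval_comp, eval_mul, eval_mul, eval_C, eval_C, eval_X, neg_one_mul, Chebyshev.T_eval_neg]
    simp
  have h1 := congrArg (fun p => p.coeff (n - 1)) h
  simp only [comp_C_mul_X_coeff, coeff_C_mul] at h1
  obtain ⟨k, rfl⟩ := Nat.exists_eq_add_of_le hn
  rw [Nat.add_sub_cancel_left, pow_add] at h1
  rw [Nat.add_sub_cancel_left]
  have h2 : ((-1 : ℝ) ^ k) ≠ 0 := by simp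
  have h3 : (-1 : ℝ) ^ k * ((Chebyshev.T ℝ (1 + k : ℕ)).coeff k) = 0 := by linarith
  exact (mul_eq_zero.mp h3).resolve_left h2

theorem abs_eval_T_le_one (n : ℕ) {x : ℝ} (hx : x ∈ Set.Icc (-1 : ℝ) 1) :
    |(Chebyshev.T ℝ n).eval x| ≤ 1 :=
  Chebyshev.abs_eval_T_real_le_one n (abs_le.mpr hx)

theorem degree_monic_sub_T {n : ℕ} {P : ℝ[X]} (hP : P.Monic) (hPd : P.natDegree = n) :
    (P - C (2 ^ (n - 1))⁻¹ * Chebyshev.T ℝ n).degree < (n : WithBot ℕ) := by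
  have h2 : ((2 : ℝ) ^ (n - 1))⁻¹ ≠ 0 := by positivity
  rw [degree_lt_iff_coeff_zero]
  intro j hj
  rw [coeff_sub, coeff_C_mul]
  rcases hj.eq_or_lt with rfl | hj
  · rw [coeff_T_natCast, ← hPd, hP.coeff_natDegree, hPd, inv_mul_cancel₀ (by positivity), sub_self]
  · rw [coeff_eq_zero_of_natDegree_lt (by omega), coeff_eq_zero_of_natDegree_lt
      (by rw [Chebyshev.natDegree_T]; simpa using hj), mul_zero, sub_zero]

/-- A monic polynomial that alternates `n` times with positive first value has nonnegative second
coefficient. -/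
theorem coeff_pred_nonneg_of_alternation {n : ℕ} (hn : 2 ≤ n) {P : ℝ[X]} (hP : P.Monic)
    (hPd : P.natDegree = n) {L : ℝ} (hL : 0 < L)
    (hPL : ∀ x ∈ Set.Icc (-1 : ℝ) 1, |P.eval x| ≤ L) {y : ℕ → ℝ}
    (hyI : ∀ i < n, y i ∈ Set.Icc (-1 : ℝ) 1) (hy : ∀ i, i + 1 < n → y (i + 1) < y i)
    (hyL : ∀ i < n, P.eval (y i) = (-1) ^ i * L) : 0 ≤ P.coeff (n - 1) := by
  have h2 : (0 : ℝ) < 2 ^ (n - 1) := by positivity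
  have hbound := one_le_two_pow_mul_of_monic hP hPd hL hPL
  have hlow : ((2 : ℝ) ^ (n - 1))⁻¹ ≤ L := by rwa [inv_le_iff_one_le_mul₀' h2]
  -- Since `L ≥ 2^(1-n)`, the monic multiple of `T_n` never exceeds `L` in modulus, so the sign of
  -- the difference at `y i` is weakly that of `P`.
  have h := coeff_nonneg_of_alternation (k := n - 1) (y := y) (fun i hi => hy i (by omega))
    (D := P - C (2 ^ (n - 1))⁻¹ * Chebyshev.T ℝ n)
    (by rw [Nat.sub_add_cancel (by omega)]; exact degree_monic_sub_T hP hPd) (by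
      intro i hi
      have hin : i < n := by omega
      have hT := abs_eval_T_le_one n (hyI i hin)
      rw [eval_sub, eval_mul, eval_C, hyL i hin]
      have h1 : ((-1 : ℝ) ^ i) * (-1) ^ i = 1 := by rw [← mul_pow]; simp
      have h3 : |(-1) ^ i * ((2 ^ (n - 1))⁻¹ * (Chebyshev.T ℝ n).eval (y i))| ≤ L := by
        rw [abs_mul, abs_neg_one_pow, one_mul, abs_mul, abs_of_pos (inv_pos.mpr h2)]
        exact (mul_le_of_le_one_right (inv_pos.mpr h2).le hT).trans hlow
      have h4 := (abs_le.mp h3).2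
      rw [mul_sub, ← mul_assoc, h1, one_mul]
      linarith)
  rwa [coeff_sub, coeff_C_mul, coeff_T_pred (by omega), mul_zero, sub_zero] at h

/-- A monic polynomial of degree `n` that alternates at `n + 1` points is a multiple of a
Chebyshev polynomial. -/
theorem eq_C_mul_T_of_alternation {n : ℕ} {P : ℝ[X]} (hP : P.Monic)
    (hPd : P.natDegree = n) {L : ℝ} (hL : 0 < L)
    (hPL : ∀ x ∈ Set.Icc (-1 : ℝ) 1, |P.eval x| ≤ L) {y : ℕ → ℝ}
    (hyI : ∀ i ≤ n, y i ∈ Set.Icc (-1 : ℝ) 1) (hy : ∀ i < n, y (i + 1) < y i)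
    (hyL : ∀ i ≤ n, P.eval (y i) = (-1) ^ i * L) : P = C L * Chebyshev.T ℝ n := by
  have h2 : (0 : ℝ) < 2 ^ (n - 1) := by positivity
  have hbound := one_le_two_pow_mul_of_monic hP hPd hL hPL
  have hlow : ((2 : ℝ) ^ (n - 1))⁻¹ ≤ L := by rwa [inv_le_iff_one_le_mul₀' h2]
  -- If `L` were larger, the difference of two monic polynomials of degree `n` would have a positive
  -- coefficient of `xⁿ`. Equality makes `P / L` extremal for the leading coefficient, which
  -- characterizes `T_n`.
  have heq : ((2 : ℝ) ^ (n - 1))⁻¹ = L := by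
    refine hlow.eq_of_not_lt fun hlt => ?_
    have hdeg := degree_monic_sub_T hP hPd
    have h := coeff_pos_of_alternation (k := n) (y := y) hy
      (D := P - C (2 ^ (n - 1))⁻¹ * Chebyshev.T ℝ n)
      (hdeg.trans (by exact_mod_cast Nat.lt_succ_self n)) (by
        intro i hi
        have hT := abs_eval_T_le_one n (hyI i hi)
        rw [eval_sub, eval_mul, eval_C, hyL i hi]
        have h1 : ((-1 : ℝ) ^ i) * (-1) ^ i = 1 := by rw [← mul_pow]; simp
        have h3 : |(-1) ^ i * ((2 ^ (n - 1))⁻¹ * (Chebyshev.T ℝ n).eval (y i))| < L := by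
          rw [abs_mul, abs_neg_one_pow, one_mul, abs_mul, abs_of_pos (inv_pos.mpr h2)]
          exact (mul_le_of_le_one_right (inv_pos.mpr h2).le hT).trans_lt hlt
        have h4 := (abs_lt.mp h3).2
        rw [mul_sub, ← mul_assoc, h1, one_mul]
        linarith)
    rw [degree_lt_iff_coeff_zero] at hdeg
    exact h.ne' (hdeg n le_rfl)
  have hLi : L⁻¹ = 2 ^ (n - 1) := by rw [← heq, inv_inv]
  have h := (Chebyshev.coeff_eq_iff_of_forall_abs_le_one (n := n) (P := C L⁻¹ * P)
    (degree_le_of_natDegree_le ((natDegree_C_mul_le _ _).trans hPd.le)) (by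
      intro x hx
      rw [eval_mul, eval_C, abs_mul, abs_of_pos (inv_pos.mpr hL)]
      exact inv_mul_le_one_of_le₀ (hPL x hx) hL.le)).mp (by
      rw [coeff_C_mul, ← hPd, hP.coeff_natDegree, hPd, mul_one, hLi])
  rw [← h, ← mul_assoc, ← C_mul, mul_inv_cancel₀ hL.ne', C_1, one_mul]

/-! ### Affine substitutions -/

theorem coeff_pred_comp_X_add_C {n : ℕ} (hn : 1 ≤ n) {P : ℝ[X]} (hP : P.Monic)
    (hPd : P.natDegree = n) (a : ℝ) :
    (P.comp (X + C a)).coeff (n - 1) = P.coeff (n - 1) + n * a := by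
  obtain ⟨k, rfl⟩ := Nat.exists_eq_add_of_le' hn
  rw [Nat.add_sub_cancel]
  have hR : (P - X ^ (k + 1) - C (P.coeff k) * X ^ k).degree < (k : WithBot ℕ) := by
    rw [degree_lt_iff_coeff_zero]
    intro j hj
    rw [coeff_sub, coeff_sub, coeff_X_pow, coeff_C_mul_X_pow]
    rcases hj.eq_or_lt with rfl | hj
    · simp
    · rcases (Nat.succ_le_of_lt hj).eq_or_lt with rfl | hj'
      · have := hP.coeff_natDegree
        rw [hPd] at this
        simp [this]
      · rw [coeff_eq_zero_of_natDegree_lt (by omega), if_neg (by omega), if_neg (by omega)]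
        simp
  obtain ⟨R, hRdef⟩ : ∃ R, R = P - X ^ (k + 1) - C (P.coeff k) * X ^ k := ⟨_, rfl⟩
  rw [← hRdef] at hR
  have hPR : P = X ^ (k + 1) + C (P.coeff k) * X ^ k + R := by rw [hRdef]; ring
  have hpow : ∀ j : ℕ, ((X + C a) ^ j).natDegree = j := fun j => by
    rw [(monic_X_add_C a).natDegree_pow, natDegree_X_add_C, mul_one]
  have hRc : (R.comp (X + C a)).coeff k = 0 := by
    refine coeff_eq_zero_of_degree_lt ?_
    rcases eq_or_ne R 0 with h0 | h0
    · rw [h0, zero_comp, degree_zero]; exact WithBot.bot_lt_coe _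
    · refine degree_le_natDegree.trans_lt ?_
      rw [natDegree_comp, natDegree_X_add_C, mul_one, ← degree_eq_natDegree h0]
      exact hR
  have h1 : ((X + C a) ^ (k + 1)).coeff k = (k + 1) * a := by
    have h := (monic_X_add_C a).nextCoeff_pow (k + 1)
    rw [nextCoeff_X_add_C, nextCoeff, hpow, if_neg (by omega), Nat.add_sub_cancel] at h
    rw [h]
    simp
  have h2 : ((X + C a) ^ k).coeff k = 1 := by
    have h := ((monic_X_add_C a).pow k).coeff_natDegree
    rwa [hpow] at h
  conv_lhs => rw [hPR]
  simp only [add_comp, mul_comp, pow_comp, X_comp, C_comp]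
  rw [coeff_add, coeff_add, hRc, h1, coeff_C_mul, h2]
  push_cast
  ring

/-- `b⁻ⁿ P(b t + a)`. -/
theorem monic_affine_comp {n : ℕ} (hn : 1 ≤ n) {P : ℝ[X]} (hP : P.Monic) (hPd : P.natDegree = n)
    (a : ℝ) {b : ℝ} (hb : b ≠ 0) :
    ∃ Q : ℝ[X], Q.Monic ∧ Q.natDegree = n ∧ (∀ t, Q.eval t = (b ^ n)⁻¹ * P.eval (b * t + a)) ∧
      b * Q.coeff (n - 1) = P.coeff (n - 1) + n * a := by
  have hm : (P.comp (X + C a)).Monic := hP.comp (monic_X_add_C a) (by simp)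
  have hd : (P.comp (X + C a)).natDegree = n := by
    rw [natDegree_comp, natDegree_X_add_C, mul_one, hPd]
  have hbn : b ^ n ≠ 0 := pow_ne_zero _ hb
  have hd2 : (C (b ^ n)⁻¹ * (P.comp (X + C a)).comp (C b * X)).natDegree = n := by
    rw [natDegree_C_mul (inv_ne_zero hbn), natDegree_comp, hd, natDegree_C_mul_X _ hb, mul_one]
  refine ⟨C (b ^ n)⁻¹ * (P.comp (X + C a)).comp (C b * X), ?_, hd2, ?_, ?_⟩
  · rw [Monic, leadingCoeff, hd2, coeff_C_mul, comp_C_mul_X_coeff]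
    have := hm.coeff_natDegree
    rw [hd] at this
    rw [this, one_mul, inv_mul_cancel₀ hbn]
  · intro t
    simp
  · rw [coeff_C_mul, comp_C_mul_X_coeff, coeff_pred_comp_X_add_C hn hP hPd]
    obtain ⟨k, rfl⟩ := Nat.exists_eq_add_of_le' hn
    rw [Nat.add_sub_cancel]
    field_simp
    ring

end ZolotarevArcs

namespace ZolotarevArcs

open Polynomial

/-! ### Location of the alternation points -/

theorem eval_derivative_eq_zero_of_abs_eq {P : ℝ[X]} {L : ℝ}
    (hPL : ∀ x ∈ Set.Icc (-1 : ℝ) 1, |P.eval x| ≤ L) {x : ℝ} (hx : x ∈ Set.Ioo (-1 : ℝ) 1)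
    (hxL : |P.eval x| = L) : P.derivative.eval x = 0 := by
  have hnhds : Set.Icc (-1 : ℝ) 1 ∈ nhds x := Icc_mem_nhds hx.1 hx.2
  have hext : IsLocalExtr (fun t => P.eval t) x := by
    rcases le_total 0 (P.eval x) with h | h
    · refine Or.inr ?_
      filter_upwards [hnhds] with t ht
      rw [abs_of_nonneg h] at hxL
      exact hxL ▸ (le_abs_self _).trans (hPL t ht)
    · refine Or.inl ?_
      filter_upwards [hnhds] with t ht
      rw [abs_of_nonpos h] at hxL
      have := (neg_le_abs (P.eval t)).trans (hPL t ht)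
      linarith
  exact hext.hasDerivAt_eq_zero (P.hasDerivAt x)

theorem eval_pos_of_roots_lt {k : ℕ} {Q : ℝ[X]} (hQd : Q.natDegree = k) (hQ : 0 < Q.leadingCoeff)
    {y : ℕ → ℝ} (hinj : Set.InjOn y (Finset.range k : Set ℕ)) (hroot : ∀ i < k, Q.eval (y i) = 0)
    {x : ℝ} (hx : ∀ i < k, y i < x) : 0 < Q.eval x := by
  have hprod : Q = C Q.leadingCoeff * ∏ i ∈ Finset.range k, (X - C (y i)) := by
    have hm : (∏ i ∈ Finset.range k, (X - C (y i))).Monic := monic_prod_X_sub_C _ _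
    have hmd : (∏ i ∈ Finset.range k, (X - C (y i))).natDegree = k := by
      rw [natDegree_finsetProd_X_sub_C_eq_card, Finset.card_range]
    refine sub_eq_zero.mp (eq_zero_of_degree_lt_of_eval_index_eq_zero (Finset.range k) hinj ?_ ?_)
    · rw [Finset.card_range, degree_lt_iff_coeff_zero]
      intro j hj
      rw [coeff_sub, coeff_C_mul]
      rcases hj.eq_or_lt with rfl | hj
      · have := hm.coeff_natDegree
        rw [hmd] at this
        rw [this, mul_one, leadingCoeff, hQd, sub_self]
      · rw [coeff_eq_zero_of_natDegree_lt (by omega), coeff_eq_zero_of_natDegree_lt (by omega),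
          mul_zero, sub_zero]
    · intro i hi
      rw [eval_sub, eval_mul, hroot i (Finset.mem_range.mp hi), eval_prod,
        Finset.prod_eq_zero hi (by simp), mul_zero, sub_zero]
  rw [hprod, eval_mul, eval_C, eval_prod]
  refine mul_pos hQ (Finset.prod_pos fun i hi => ?_)
  rw [eval_sub, eval_X, eval_C]
  exact sub_pos.mpr (hx i (Finset.mem_range.mp hi))

theorem leadingCoeff_derivative_pos {n : ℕ} (hn : 1 ≤ n) {P : ℝ[X]} (hP : P.Monic)
    (hPd : P.natDegree = n) :
    P.derivative.natDegree = n - 1 ∧ 0 < P.derivative.leadingCoeff := by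
  have hd : P.derivative.natDegree = n - 1 := by
    rw [natDegree_derivative, hPd]
  refine ⟨hd, ?_⟩
  rw [leadingCoeff, hd, coeff_derivative, Nat.sub_add_cancel hn, ← hPd, hP.coeff_natDegree]
  positivity

/-- If all critical points are `y 0, …, y (n - 2)`, then `P` increases beyond the largest. -/
theorem strictMonoOn_Ici_of_critical {n : ℕ} (hn : 2 ≤ n) {P : ℝ[X]} (hP : P.Monic)
    (hPd : P.natDegree = n) {y : ℕ → ℝ} (hy : ∀ i, i + 1 < n - 1 → y (i + 1) < y i)
    (hcrit : ∀ i < n - 1, P.derivative.eval (y i) = 0) :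
    StrictMonoOn (fun x => P.eval x) (Set.Ici (y 0)) := by
  obtain ⟨hd, hlc⟩ := leadingCoeff_derivative_pos (by omega) hP hPd
  have hanti : StrictAntiOn y (Set.Iio (n - 1)) :=
    strictAntiOn_of_succ_lt Set.ordConnected_Iio fun i _ _ hi => hy i hi
  have hinj : Set.InjOn y (Finset.range (n - 1) : Set ℕ) := by
    rw [Finset.coe_range]
    exact hanti.injOn
  refine strictMonoOn_of_deriv_pos (convex_Ici _) P.continuous.continuousOn fun x hx => ?_
  rw [interior_Ici, Set.mem_Ioi] at hx
  rw [Polynomial.deriv]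
  refine eval_pos_of_roots_lt hd hlc hinj hcrit fun i hi => lt_of_le_of_lt ?_ hx
  exact hanti.antitoneOn (Set.mem_Iio.mpr (by omega)) (Set.mem_Iio.mpr hi) (Nat.zero_le i)

theorem exists_gt_eval_eq {P : ℝ[X]} (hP : P.Monic) (hPd : 0 < P.natDegree) {x L : ℝ}
    (hx : P.eval x < L) : ∃ γ, x < γ ∧ P.eval γ = L := by
  have ht := P.tendsto_atTop_of_leadingCoeff_nonneg (natDegree_pos_iff_degree_pos.mp hPd)
    (by rw [hP.leadingCoeff]; norm_num)
  obtain ⟨b, hb, hxb⟩ := ((ht.eventually_ge_atTop L).and (Filter.eventually_ge_atTop x)).exists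
  obtain ⟨γ, hγ, hγL⟩ := intermediate_value_Icc hxb P.continuous.continuousOn ⟨hx.le, hb⟩
  refine ⟨γ, lt_of_le_of_ne hγ.1 ?_, hγL⟩
  rintro rfl
  exact hx.ne hγL

/-- The right side is the largest interior extremum of `T_n` stretched to `[-1, 1 + 2σ]`. The
half-angle formula turns the bound on `σ` into the statement that this point lies beyond `1`. -/
theorem cos_bound_of_tan_sq_lt {n : ℕ} (hn : 2 ≤ n) {σ : ℝ}
    (hσ : Real.tan (Real.pi / (2 * (n : ℝ))) ^ 2 < σ) :
    1 < σ + (1 + σ) * Real.cos (1 * Real.pi / n) := by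
  have hn' : (2 : ℝ) ≤ n := by exact_mod_cast hn
  have hpi := Real.pi_pos
  have hφ : (1 : ℝ) * Real.pi / n = 2 * (Real.pi / (2 * (n : ℝ))) := by field_simp
  have hcos : 0 < Real.cos (Real.pi / (2 * (n : ℝ))) := by
    refine Real.cos_pos_of_mem_Ioo ⟨?_, ?_⟩
    · have : 0 < Real.pi / (2 * (n : ℝ)) := by positivity
      linarith
    · exact div_lt_div_of_pos_left hpi two_pos (by linarith)
  rw [hφ, Real.cos_two_mul]
  have h1 : Real.sin (Real.pi / (2 * (n : ℝ))) ^ 2 <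
      σ * Real.cos (Real.pi / (2 * (n : ℝ))) ^ 2 := by
    have := mul_lt_mul_of_pos_right hσ (pow_pos hcos 2)
    rwa [← mul_pow, Real.tan_mul_cos hcos.ne'] at this
  nlinarith [Real.sin_sq_add_cos_sq (Real.pi / (2 * (n : ℝ)))]

/-- The stretched Chebyshev polynomial alternating at `-1 = y (n - 1), …, y 0 ≤ 1` with `y 0` a
critical point is excluded by the lower bound on `σ`. -/
theorem eval_derivative_ne_zero {n : ℕ} (hn : 2 ≤ n) {σ : ℝ}
    (hσ : Real.tan (Real.pi / (2 * (n : ℝ))) ^ 2 < σ) {P : ℝ[X]} (hP : P.Monic)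
    (hPd : P.natDegree = n) (hPc : P.coeff (n - 1) = -(n * σ)) {L : ℝ} (hL : 0 < L)
    (hPL : ∀ x ∈ Set.Icc (-1 : ℝ) 1, |P.eval x| ≤ L) {y : ℕ → ℝ}
    (hyI : ∀ i < n, y i ∈ Set.Icc (-1 : ℝ) 1) (hy : ∀ i, i + 1 < n → y (i + 1) < y i)
    (hyL : ∀ i < n, P.eval (y i) = -((-1) ^ i * L)) : P.derivative.eval (y 0) ≠ 0 := by
  intro h0
  have hanti : StrictAntiOn y (Set.Iio n) :=
    strictAntiOn_of_succ_lt Set.ordConnected_Iio fun i _ _ hi => hy i hi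
  have hyabs : ∀ i < n, |P.eval (y i)| = L := fun i hi => by
    rw [hyL i hi, abs_neg, abs_mul, abs_neg_one_pow, one_mul, abs_of_pos hL]
  have hcrit : ∀ i, i < n → -1 < y i → P.derivative.eval (y i) = 0 := by
    intro i hi h1
    rcases Nat.eq_zero_or_pos i with rfl | hpos
    · exact h0
    · refine eval_derivative_eq_zero_of_abs_eq hPL ⟨h1, ?_⟩ (hyabs i hi)
      exact (hanti (Set.mem_Iio.mpr (by omega)) (Set.mem_Iio.mpr hi) hpos).trans_le
        (hyI 0 (by omega)).2
  have hgt : ∀ i < n - 1, -1 < y i := fun i hi =>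
    (hyI (n - 1) (by omega)).1.trans_lt
      (hanti (Set.mem_Iio.mpr (by omega)) (Set.mem_Iio.mpr (by omega)) hi)
  obtain ⟨hd, hlc⟩ := leadingCoeff_derivative_pos (by omega) hP hPd
  -- Otherwise all `n` points would be zeros of the derivative, whose degree is `n - 1`.
  have hlast : y (n - 1) = -1 := by
    by_contra hne
    have hlt : -1 < y (n - 1) := lt_of_le_of_ne (hyI (n - 1) (by omega)).1 (Ne.symm hne)
    have hz : P.derivative = 0 := by
      refine eq_zero_of_degree_lt_of_eval_index_eq_zero (Finset.range n)
        (by rw [Finset.coe_range]; exact hanti.injOn) ?_ fun i hi => ?_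
      · rw [Finset.card_range]
        refine degree_le_natDegree.trans_lt ?_
        rw [hd]
        exact_mod_cast (by omega : n - 1 < n)
      · have hi := Finset.mem_range.mp hi
        refine hcrit i hi ?_
        rcases Nat.lt_or_ge i (n - 1) with h | h
        · exact hgt i h
        · obtain rfl : i = n - 1 := by omega
          exact hlt
    rw [hz, leadingCoeff_zero] at hlc
    exact lt_irrefl _ hlc
  have hmono : StrictMonoOn (fun x => P.eval x) (Set.Ici (y 0)) :=
    strictMonoOn_Ici_of_critical hn hP hPd (fun i hi => hy i (by omega))
      fun i hi => hcrit i (by omega) (hgt i hi)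
  have hP0 : P.eval (y 0) = -L := by rw [hyL 0 (by omega)]; simp
  -- The point `γ` supplies the missing alternation point: on `[-1, γ]` there are `n + 1`, and the
  -- affine map onto `[-1,1]` yields a multiple of `T_n`.
  obtain ⟨γ, hγ, hγL⟩ := exists_gt_eval_eq hP (by omega) (x := y 0) (L := L) (by linarith)
  have hy0 : -1 < y 0 := hgt 0 (by omega)
  have hbound : ∀ x ∈ Set.Icc (-1 : ℝ) γ, |P.eval x| ≤ L := by
    intro x hx
    rcases le_total x (y 0) with h | h
    · exact hPL x ⟨hx.1, h.trans (hyI 0 (by omega)).2⟩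
    · have h1 := hmono.monotoneOn (Set.mem_Ici.mpr le_rfl) (Set.mem_Ici.mpr h) h
      have h2 := hmono.monotoneOn (Set.mem_Ici.mpr h) (Set.mem_Ici.mpr hγ.le) hx.2
      exact abs_le.mpr ⟨by linarith, by linarith⟩
  obtain ⟨b, hb⟩ : ∃ b, b = (γ + 1) / 2 := ⟨_, rfl⟩
  obtain ⟨a, ha⟩ : ∃ a, a = (γ - 1) / 2 := ⟨_, rfl⟩
  have hbpos : 0 < b := by rw [hb]; linarith
  have hbn : 0 < b ^ n := pow_pos hbpos n
  obtain ⟨Q, hQ, hQd, hQe, hQc⟩ := monic_affine_comp (by omega) hP hPd a hbpos.ne'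
  have hmem : ∀ x ∈ Set.Icc (-1 : ℝ) γ, (x - a) / b ∈ Set.Icc (-1 : ℝ) 1 := by
    intro x hx
    rw [Set.mem_Icc, le_div_iff₀ hbpos, div_le_iff₀ hbpos]
    constructor <;> linarith [hx.1, hx.2]
  have hback : ∀ x, Q.eval ((x - a) / b) = (b ^ n)⁻¹ * P.eval x := by
    intro x
    rw [hQe, mul_div_cancel₀ _ hbpos.ne', sub_add_cancel]
  have hQT : Q = C ((b ^ n)⁻¹ * L) * Chebyshev.T ℝ n := by
    refine eq_C_mul_T_of_alternation hQ hQd (mul_pos (inv_pos.mpr hbn) hL) ?_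
      (y := fun i => i.casesOn ((γ - a) / b) fun j => (y j - a) / b) ?_ ?_ ?_
    · intro t ht
      rw [hQe, abs_mul, abs_of_pos (inv_pos.mpr hbn)]
      refine mul_le_mul_of_nonneg_left (hbound _ ⟨?_, ?_⟩) (inv_pos.mpr hbn).le
      · nlinarith [ht.1, ht.2]
      · nlinarith [ht.1, ht.2]
    · intro i hi
      cases i with
      | zero => exact hmem γ ⟨by linarith, le_rfl⟩
      | succ j =>
        refine hmem _ ⟨(hyI j (by omega)).1, le_trans ?_ hγ.le⟩
        exact hanti.antitoneOn (Set.mem_Iio.mpr (by omega)) (Set.mem_Iio.mpr (by omega))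
          (Nat.zero_le j)
    · intro i hi
      cases i with
      | zero => exact div_lt_div_of_pos_right (by linarith) hbpos
      | succ j => exact div_lt_div_of_pos_right (by linarith [hy j (by omega)]) hbpos
    · intro i hi
      cases i with
      | zero =>
        change Q.eval ((γ - a) / b) = _
        rw [hback, hγL]; simp
      | succ j =>
        change Q.eval ((y j - a) / b) = _
        rw [hback, hyL j (by omega), pow_succ]; ring
  -- `T_n` has no term of degree `n - 1`, which fixes the translation.
  have haσ : a = σ := by
    have hn0 : (n : ℝ) ≠ 0 := by positivity
    have h1 : Q.coeff (n - 1) = 0 := by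
      rw [hQT, coeff_C_mul, coeff_T_pred (by omega), mul_zero]
    rw [h1, mul_zero, hPc] at hQc
    have h2 : (n : ℝ) * (a - σ) = 0 := by linarith
    have := (mul_eq_zero.mp h2).resolve_left hn0
    linarith
  have hbσ : b = 1 + σ := by rw [← haσ, ha, hb]; ring
  -- The image of `cos(π/n)` lies beyond `1 ≥ y 0` and again has value `-L`, although `P` increases
  -- strictly from `P(y 0) = -L`.
  have hnode : P.eval (b * Chebyshev.node n 1 + a) = -L := by
    have h1 := hQe (Chebyshev.node n 1)
    rw [hQT, eval_mul, eval_C, Chebyshev.eval_T_real_node (Finset.mem_Iic.mpr (by omega))] at h1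
    have hbi : (b ^ n)⁻¹ ≠ 0 := (inv_pos.mpr hbn).ne'
    have h2 : (b ^ n)⁻¹ * (P.eval (b * Chebyshev.node n 1 + a) + L) = 0 := by linarith
    have := (mul_eq_zero.mp h2).resolve_left hbi
    linarith
  have hcos := cos_bound_of_tan_sq_lt hn hσ
  have hlt : y 0 < b * Chebyshev.node n 1 + a := by
    have hy01 := (hyI 0 (by omega)).2
    rw [haσ, hbσ, Chebyshev.node, Nat.cast_one]
    linarith
  have := hmono (Set.mem_Ici.mpr le_rfl) (Set.mem_Ici.mpr hlt.le) hlt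
  simp only at this
  linarith

/-- The alternation points of a Zolotarev polynomial include `1` and `-1`, all others being critical
points, and the polynomial decreases at `1` to its minimum. -/
theorem alternation_endpoints {n : ℕ} (hn : 2 ≤ n) {σ : ℝ}
    (hσ : Real.tan (Real.pi / (2 * (n : ℝ))) ^ 2 < σ) {P : ℝ[X]} (hP : P.Monic)
    (hPd : P.natDegree = n) (hPc : P.coeff (n - 1) = -(n * σ)) {L : ℝ} (hL : 0 < L)
    (hPL : ∀ x ∈ Set.Icc (-1 : ℝ) 1, |P.eval x| ≤ L) {y : ℕ → ℝ}
    (hyI : ∀ i < n, y i ∈ Set.Icc (-1 : ℝ) 1) (hy : ∀ i, i + 1 < n → y (i + 1) < y i)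
    (hy0 : |P.eval (y 0)| = L) (hya : ∀ i < n, P.eval (y i) = (-1) ^ i * P.eval (y 0)) :
    (∀ i < n, P.eval (y i) = -((-1) ^ i * L)) ∧ y 0 = 1 ∧ y (n - 1) = -1 ∧
      (∀ i, 0 < i → i < n - 1 → P.derivative.eval (y i) = 0) ∧ P.derivative.eval 1 < 0 := by
  have hσ0 : 0 < σ := (sq_nonneg _).trans_lt hσ
  have hn0 : (0 : ℝ) < n := by positivity
  -- Starting with `+L` would make the coefficient `-nσ` nonnegative.
  have hneg : P.eval (y 0) = -L := by
    rcases (abs_eq hL.le).mp hy0 with h | h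
    · exfalso
      have := coeff_pred_nonneg_of_alternation hn hP hPd hL hPL hyI hy
        fun i hi => by rw [hya i hi, h]
      rw [hPc] at this
      nlinarith [mul_pos hn0 hσ0]
    · exact h
  have hyL : ∀ i < n, P.eval (y i) = -((-1) ^ i * L) := fun i hi => by
    rw [hya i hi, hneg]; ring
  have hyabs : ∀ i < n, |P.eval (y i)| = L := fun i hi => by
    rw [hyL i hi, abs_neg, abs_mul, abs_neg_one_pow, one_mul, abs_of_pos hL]
  have hanti : StrictAntiOn y (Set.Iio n) :=
    strictAntiOn_of_succ_lt Set.ordConnected_Iio fun i _ _ hi => hy i hi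
  have hder := eval_derivative_ne_zero hn hσ hP hPd hPc hL hPL hyI hy hyL
  have hlt1 : ∀ i, 0 < i → i < n → y i < 1 := fun i h0 hi =>
    (hanti (Set.mem_Iio.mpr (by omega)) (Set.mem_Iio.mpr hi) h0).trans_le (hyI 0 (by omega)).2
  have hgt : ∀ i < n - 1, -1 < y i := fun i hi =>
    (hyI (n - 1) (by omega)).1.trans_lt
      (hanti (Set.mem_Iio.mpr (by omega)) (Set.mem_Iio.mpr (by omega)) hi)
  have hone : y 0 = 1 := by
    by_contra hne
    exact hder (eval_derivative_eq_zero_of_abs_eq hPL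
      ⟨hgt 0 (by omega), lt_of_le_of_ne (hyI 0 (by omega)).2 hne⟩ (hyabs 0 (by omega)))
  -- Otherwise `y 1, …, y (n - 1)` are all the critical points and `P` increases beyond `y 1`, yet
  -- it falls from `L` at `y 1` to `-L` at `y 0`.
  have hlast : y (n - 1) = -1 := by
    by_contra hne
    have hlt : -1 < y (n - 1) := lt_of_le_of_ne (hyI (n - 1) (by omega)).1 (Ne.symm hne)
    have hmono := strictMonoOn_Ici_of_critical hn hP hPd (y := fun i => y (i + 1))
      (fun i hi => hy (i + 1) (by omega)) fun i hi => by
        refine eval_derivative_eq_zero_of_abs_eq hPL ⟨?_, hlt1 (i + 1) (by omega) (by omega)⟩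
          (hyabs _ (by omega))
        rcases Nat.lt_or_ge (i + 1) (n - 1) with h | h
        · exact hgt _ h
        · rwa [show i + 1 = n - 1 by omega]
    have h10 := hy 0 (by omega)
    have h := hmono (Set.mem_Ici.mpr le_rfl) (Set.mem_Ici.mpr h10.le) h10
    simp only [hneg, hyL (0 + 1) (by omega)] at h
    norm_num at h
    linarith
  refine ⟨hyL, hone, hlast, fun i h0 hi => eval_derivative_eq_zero_of_abs_eq hPL
    ⟨hgt i hi, hlt1 i h0 (by omega)⟩ (hyabs i (by omega)), ?_⟩
  rw [hone] at hder hneg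
  -- A positive derivative at `1` would push `P` below `-L` just to the left of `1`.
  refine lt_of_le_of_ne (not_lt.mp fun hpos => ?_) hder
  obtain ⟨G, hG⟩ : X - C 1 ∣ P + C L := by
    rw [dvd_iff_isRoot, IsRoot, eval_add, eval_C, hneg, neg_add_cancel]
  have hG1 : P.derivative.eval 1 = G.eval 1 := by
    have := congrArg (fun p => (derivative p).eval 1) hG
    simpa using this
  rw [hG1] at hpos
  have hev : ∀ᶠ x in nhdsWithin (1 : ℝ) (Set.Iio 1), 0 < G.eval x :=
    (G.continuous.continuousAt.eventually (lt_mem_nhds hpos)).filter_mono nhdsWithin_le_nhds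
  obtain ⟨x, hx, hxI⟩ := (hev.and (Ioo_mem_nhdsLT (by norm_num : (-1 : ℝ) < 1))).exists
  have h1 := (abs_le.mp (hPL x ⟨hxI.1.le, hxI.2.le⟩)).1
  have h2 := congrArg (fun p => p.eval x) hG
  simp only [eval_add, eval_C, eval_mul, eval_sub, eval_X] at h2
  nlinarith [mul_pos hx (sub_pos.mpr hxI.2)]

end ZolotarevArcs

namespace ZolotarevArcs

open Polynomial

/-! ### Factorization of `P - L` and `P + L` -/

theorem prod_sq_dvd {s : Finset ℕ} {f : ℕ → ℝ} (hf : Set.InjOn f (s : Set ℕ)) {Q : ℝ[X]}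
    (hQ : ∀ k ∈ s, Q.eval (f k) = 0 ∧ Q.derivative.eval (f k) = 0) :
    (∏ k ∈ s, (X - C (f k))) ^ 2 ∣ Q := by
  rw [← Finset.prod_pow]
  refine Finset.prod_dvd_of_coprime (fun i hi j hj hij => ?_) fun k hk => ?_
  · exact (isCoprime_X_sub_C_of_isUnit_sub
      (sub_ne_zero.mpr (hf.ne hi hj hij)).isUnit).pow
  · rcases eq_or_ne Q 0 with rfl | h0
    · exact dvd_zero _
    · exact (le_rootMultiplicity_iff h0).mp ((one_lt_rootMultiplicity_iff_isRoot h0).mpr (hQ k hk))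

theorem X_sub_C_mul_dvd {Q W : ℝ[X]} {a : ℝ} (hQ : Q.eval a = 0) (hW : W ∣ Q)
    (hWa : W.eval a ≠ 0) : (X - C a) * W ∣ Q := by
  refine IsCoprime.mul_dvd ?_ (dvd_iff_isRoot.mpr hQ) hW
  rw [(irreducible_X_sub_C a).coprime_iff_not_dvd, dvd_iff_isRoot]
  exact hWa

theorem eq_of_dvd_of_natDegree_eq {Q W : ℝ[X]} (hQ : Q.Monic) (hW : W.Monic) (hdvd : W ∣ Q)
    (hd : Q.natDegree = W.natDegree) : Q = W :=
  eq_of_monic_of_dvd_of_natDegree_le hW hQ hdvd hd.le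

theorem exists_eq_X_sub_C_mul {Q W : ℝ[X]} (hQ : Q.Monic) (hW : W.Monic) (hdvd : W ∣ Q)
    (hd : Q.natDegree = W.natDegree + 1) : ∃ α, Q = (X - C α) * W := by
  obtain ⟨S, rfl⟩ := hdvd
  have hS : S.Monic := hW.of_mul_monic_left hQ
  rw [hW.natDegree_mul hS] at hd
  refine ⟨-S.coeff 0, ?_⟩
  conv_lhs => rw [hS.eq_X_add_C (by omega)]
  rw [C_neg, sub_neg_eq_add, mul_comm]

theorem eval_prod_X_sub_C_ne_zero {s : Finset ℕ} {f : ℕ → ℝ} {a : ℝ} (h : ∀ k ∈ s, f k ≠ a) :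
    ((∏ k ∈ s, (X - C (f k))) ^ 2 : ℝ[X]).eval a ≠ 0 := by
  rw [eval_pow, eval_prod]
  refine pow_ne_zero _ (Finset.prod_ne_zero_iff.mpr fun k hk => ?_)
  rw [eval_sub, eval_X, eval_C]
  exact sub_ne_zero.mpr (h k hk).symm

/-- The zeros of `U` in `ℂ` all lie in `[-1, 1]`. -/
def RootsInIcc (U : ℝ[X]) : Prop :=
  ∀ z : ℂ, (U.map Complex.ofRealHom).eval z = 0 → ∃ x ∈ Set.Icc (-1 : ℝ) 1, (x : ℂ) = z

theorem rootsInIcc_prod {s : Finset ℕ} {f : ℕ → ℝ} (h : ∀ k ∈ s, f k ∈ Set.Icc (-1 : ℝ) 1) :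
    RootsInIcc (∏ k ∈ s, (X - C (f k))) := by
  intro z hz
  rw [Polynomial.map_prod, eval_prod, Finset.prod_eq_zero_iff] at hz
  obtain ⟨k, hk, hz⟩ := hz
  refine ⟨f k, h k hk, ?_⟩
  simp only [Polynomial.map_sub, map_X, map_C, eval_sub, eval_X, eval_C] at hz
  exact (sub_eq_zero.mp hz).symm

theorem monic_add_C {n : ℕ} (hn : 1 ≤ n) {P : ℝ[X]} (hP : P.Monic) (hPd : P.natDegree = n)
    (c : ℝ) : (P + C c).Monic ∧ (P + C c).natDegree = n :=
  ⟨hP.add_of_left (degree_C_le.trans_lt (natDegree_pos_iff_degree_pos.mp (by omega))),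
    by rw [natDegree_add_C, hPd]⟩

section Factorization

variable {n : ℕ} {P : ℝ[X]} {L : ℝ} {y : ℕ → ℝ}

/-- Interior alternation points whose indices share a parity carry the same value and are critical,
hence double zeros of `P + c`. The cases `a = 1` and `a = 2` give `U` (value `L`) and `V` (value
`-L`). -/
theorem exists_factor {a j : ℕ} (c ε : ℝ) (hanti : StrictAntiOn y (Set.Iio n))
    (hyI : ∀ i < n, y i ∈ Set.Icc (-1 : ℝ) 1)
    (hcrit : ∀ i, 0 < i → i < n - 1 → P.derivative.eval (y i) = 0)
    (ha : 0 < a) (haj : ∀ k < j, 2 * k + a < n - 1) (hε : c = -ε)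
    (hyL : ∀ k < j, P.eval (y (2 * k + a)) = ε) :
    ∃ U : ℝ[X], U.Monic ∧ U.natDegree = j ∧ RootsInIcc U ∧ U ^ 2 ∣ P + C c ∧
      ∀ x, (∀ i, 0 < i → i < n - 1 → y i ≠ x) → (U ^ 2).eval x ≠ 0 := by
  refine ⟨∏ k ∈ Finset.range j, (X - C (y (2 * k + a))), monic_prod_X_sub_C _ _,
    by rw [natDegree_finsetProd_X_sub_C_eq_card, Finset.card_range],
    rootsInIcc_prod fun k hk => ?_, prod_sq_dvd ?_ fun k hk => ?_, fun x hx => ?_⟩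
  · have := haj k (Finset.mem_range.mp hk)
    exact hyI _ (by omega)
  · intro k hk k' hk' h
    have h1 := haj k (Finset.mem_range.mp (Finset.mem_coe.mp hk))
    have h2 := haj k' (Finset.mem_range.mp (Finset.mem_coe.mp hk'))
    have := hanti.injOn (Set.mem_Iio.mpr (by omega)) (Set.mem_Iio.mpr (by omega)) h
    omega
  · have hk := Finset.mem_range.mp hk
    rw [eval_add, eval_C, hyL k hk, hε, derivative_add, derivative_C, add_zero]
    exact ⟨by ring, hcrit _ (by omega) (haj k hk)⟩
  · refine eval_prod_X_sub_C_ne_zero fun k hk => ?_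
    exact hx _ (by omega) (haj k (Finset.mem_range.mp hk))

/-- For `P - L`, `m` double zeros together with `-1` and `β` fill the degree. For `P + L`, the
double zeros and `1` leave one linear factor, which defines `α`; its position is settled later. -/
theorem even_factorization {m : ℕ} (hn : n = 2 * m + 2) (hP : P.Monic)
    (hPd : P.natDegree = n)
    (hyI : ∀ i < n, y i ∈ Set.Icc (-1 : ℝ) 1) (hy : ∀ i, i + 1 < n → y (i + 1) < y i)
    (hyL : ∀ i < n, P.eval (y i) = -((-1) ^ i * L)) (hy0 : y 0 = 1) (hy1 : y (n - 1) = -1)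
    (hcrit : ∀ i, 0 < i → i < n - 1 → P.derivative.eval (y i) = 0)
    {β : ℝ} (hβ : 1 < β) (hPβ : P.eval β = L) :
    ∃ (α : ℝ) (U V : ℝ[X]), U.Monic ∧ V.Monic ∧ U.natDegree = m ∧ V.natDegree = m ∧
      RootsInIcc U ∧ RootsInIcc V ∧
      P + C (-L) = (X - C β) * ((X - C (-1)) * U ^ 2) ∧
      P + C L = (X - C 1) * ((X - C α) * V ^ 2) := by
  have hanti : StrictAntiOn y (Set.Iio n) :=
    strictAntiOn_of_succ_lt Set.ordConnected_Iio fun i _ _ hi => hy i hi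
  have hne : ∀ i, 0 < i → i < n - 1 → y i < 1 ∧ -1 < y i := fun i h0 hi =>
    ⟨hy0 ▸ hanti (Set.mem_Iio.mpr (by omega)) (Set.mem_Iio.mpr (by omega)) h0,
      hy1 ▸ hanti (Set.mem_Iio.mpr (by omega)) (Set.mem_Iio.mpr (by omega)) hi⟩
  obtain ⟨U, hU, hUd, hUr, hUdvd, hUe⟩ := exists_factor (a := 1) (j := m) (-L) L hanti hyI hcrit
    one_pos (fun k hk => by omega) rfl
    (fun k hk => by rw [hyL _ (by omega), pow_succ, pow_mul]; simp)
  obtain ⟨V, hV, hVd, hVr, hVdvd, hVe⟩ := exists_factor (a := 2) (j := m) L (-L) hanti hyI hcrit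
    two_pos (fun k hk => by omega) (by ring)
    (fun k hk => by rw [hyL _ (by omega), pow_add, pow_mul]; simp)
  have hP1 : P.eval 1 = -L := by rw [← hy0, hyL 0 (by omega)]; simp
  have hPm1 : P.eval (-1) = L := by
    rw [← hy1, hyL _ (by omega), show n - 1 = 2 * m + 1 by omega, pow_succ, pow_mul]; simp
  obtain ⟨hm1, hd1⟩ := monic_add_C (by omega) hP hPd (-L)
  obtain ⟨hm2, hd2⟩ := monic_add_C (by omega) hP hPd L
  have hdvd1 : (X - C β) * ((X - C (-1)) * U ^ 2) ∣ P + C (-L) := by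
    refine X_sub_C_mul_dvd (by simp [hPβ]) (X_sub_C_mul_dvd (by simp [hPm1]) hUdvd ?_) ?_
    · exact hUe _ fun i h0 hi => (hne i h0 hi).2.ne'
    · rw [eval_mul]
      refine mul_ne_zero ?_ (hUe _ fun i h0 hi => ((hne i h0 hi).1.trans hβ).ne)
      rw [eval_sub, eval_X, eval_C]
      linarith
  have hdvd2 : (X - C 1) * V ^ 2 ∣ P + C L :=
    X_sub_C_mul_dvd (by simp [hP1]) hVdvd (hVe _ fun i h0 hi => (hne i h0 hi).1.ne)
  have hU2 := hU.pow 2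
  have hV2 := hV.pow 2
  obtain ⟨α, hα⟩ := exists_eq_X_sub_C_mul hm2 ((monic_X_sub_C 1).mul hV2) hdvd2
    (by rw [hd2, natDegree_X_sub_C_mul _ hV2, hV.natDegree_pow, hVd]; omega)
  refine ⟨α, U, V, hU, hV, hUd, hVd, hUr, hVr, ?_, by rw [hα]; ring⟩
  exact eq_of_dvd_of_natDegree_eq hm1 ((monic_X_sub_C _).mul ((monic_X_sub_C _).mul hU2)) hdvd1
    (by rw [hd1, natDegree_X_sub_C_mul _ ((monic_X_sub_C _).mul hU2), natDegree_X_sub_C_mul _ hU2,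
      hU.natDegree_pow, hUd]; omega)

/-- Now `P(-1) = -L`, so the zero `-1` passes from `P - L` to `P + L`, and `P - L` gains a double
zero. -/
theorem odd_factorization {m : ℕ} (hn : n = 2 * m + 3) (hP : P.Monic)
    (hPd : P.natDegree = n)
    (hyI : ∀ i < n, y i ∈ Set.Icc (-1 : ℝ) 1) (hy : ∀ i, i + 1 < n → y (i + 1) < y i)
    (hyL : ∀ i < n, P.eval (y i) = -((-1) ^ i * L)) (hy0 : y 0 = 1) (hy1 : y (n - 1) = -1)
    (hcrit : ∀ i, 0 < i → i < n - 1 → P.derivative.eval (y i) = 0)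
    {β : ℝ} (hβ : 1 < β) (hPβ : P.eval β = L) :
    ∃ (α : ℝ) (U V : ℝ[X]), U.Monic ∧ V.Monic ∧ U.natDegree = m + 1 ∧ V.natDegree = m ∧
      RootsInIcc U ∧ RootsInIcc V ∧
      P + C (-L) = (X - C β) * U ^ 2 ∧
      P + C L = (X - C 1) * ((X - C (-1)) * ((X - C α) * V ^ 2)) := by
  have hanti : StrictAntiOn y (Set.Iio n) :=
    strictAntiOn_of_succ_lt Set.ordConnected_Iio fun i _ _ hi => hy i hi
  have hne : ∀ i, 0 < i → i < n - 1 → y i < 1 ∧ -1 < y i := fun i h0 hi =>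
    ⟨hy0 ▸ hanti (Set.mem_Iio.mpr (by omega)) (Set.mem_Iio.mpr (by omega)) h0,
      hy1 ▸ hanti (Set.mem_Iio.mpr (by omega)) (Set.mem_Iio.mpr (by omega)) hi⟩
  obtain ⟨U, hU, hUd, hUr, hUdvd, hUe⟩ := exists_factor (a := 1) (j := m + 1) (-L) L hanti hyI
    hcrit one_pos (fun k hk => by omega) rfl
    (fun k hk => by rw [hyL _ (by omega), pow_succ, pow_mul]; simp)
  obtain ⟨V, hV, hVd, hVr, hVdvd, hVe⟩ := exists_factor (a := 2) (j := m) L (-L) hanti hyI hcrit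
    two_pos (fun k hk => by omega) (by ring)
    (fun k hk => by rw [hyL _ (by omega), pow_add, pow_mul]; simp)
  have hP1 : P.eval 1 = -L := by rw [← hy0, hyL 0 (by omega)]; simp
  have hPm1 : P.eval (-1) = -L := by
    rw [← hy1, hyL _ (by omega), show n - 1 = 2 * (m + 1) by omega, pow_mul]; simp
  obtain ⟨hm1, hd1⟩ := monic_add_C (by omega) hP hPd (-L)
  obtain ⟨hm2, hd2⟩ := monic_add_C (by omega) hP hPd L
  have hdvd1 : (X - C β) * U ^ 2 ∣ P + C (-L) :=
    X_sub_C_mul_dvd (by simp [hPβ]) hUdvd (hUe _ fun i h0 hi => ((hne i h0 hi).1.trans hβ).ne)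
  have hdvd2 : (X - C 1) * ((X - C (-1)) * V ^ 2) ∣ P + C L := by
    refine X_sub_C_mul_dvd (by simp [hP1]) (X_sub_C_mul_dvd (by simp [hPm1]) hVdvd ?_) ?_
    · exact hVe _ fun i h0 hi => (hne i h0 hi).2.ne'
    · rw [eval_mul]
      refine mul_ne_zero ?_ (hVe _ fun i h0 hi => (hne i h0 hi).1.ne)
      rw [eval_sub, eval_X, eval_C]
      norm_num
  have hU2 := hU.pow 2
  have hV2 := hV.pow 2
  obtain ⟨α, hα⟩ := exists_eq_X_sub_C_mul hm2
    ((monic_X_sub_C 1).mul ((monic_X_sub_C (-1)).mul hV2)) hdvd2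
    (by rw [hd2, natDegree_X_sub_C_mul _ ((monic_X_sub_C _).mul hV2), natDegree_X_sub_C_mul _ hV2,
      hV.natDegree_pow, hVd]; omega)
  refine ⟨α, U, V, hU, hV, hUd, hVd, hUr, hVr, ?_, by rw [hα]; ring⟩
  exact eq_of_dvd_of_natDegree_eq hm1 ((monic_X_sub_C _).mul hU2) hdvd1
    (by rw [hd1, natDegree_X_sub_C_mul _ hU2, hU.natDegree_pow, hUd]; omega)

/-! ### The inverse image -/

/-- The intermediate value theorem gives `n` distinct real solutions, `n - 1` between consecutive
alternation points and one in `(α,β)`; a further `z` would be one zero too many. -/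
theorem eq_ofReal_of_abs_lt {α β t : ℝ} (hPd : P.natDegree = n) (hn : 1 ≤ n)
    (hyI : ∀ i < n, y i ∈ Set.Icc (-1 : ℝ) 1) (hy : ∀ i, i + 1 < n → y (i + 1) < y i)
    (hyL : ∀ i < n, P.eval (y i) = -((-1) ^ i * L)) (hα : 1 < α) (hαβ : α < β)
    (hPα : P.eval α = -L) (hPβ : P.eval β = L) (ht : t ∈ Set.Ioo (-L) L) {z : ℂ}
    (hz : (P.map Complex.ofRealHom).eval z = (t : ℂ)) :
    ∃ x ∈ Set.Icc (-1 : ℝ) 1 ∪ Set.Icc α β, (x : ℂ) = z := by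
  have hanti : StrictAntiOn y (Set.Iio n) :=
    strictAntiOn_of_succ_lt Set.ordConnected_Iio fun i _ _ hi => hy i hi
  have hroot : ∀ i, ∃ r : ℝ, (i + 1 < n → r ∈ Set.Ioo (y (i + 1)) (y i) ∧ P.eval r = t) := by
    intro i
    by_cases hi : i + 1 < n
    · have h1 := hyL i (by omega)
      have h2 := hyL (i + 1) hi
      have hle := (hy i hi).le
      rcases neg_one_pow_eq_or ℝ i with h | h
      · rw [h] at h1
        rw [pow_succ, h] at h2
        obtain ⟨r, hr, hrt⟩ := intermediate_value_Ioo' hle (f := fun x => P.eval x)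
          P.continuous.continuousOn
          (show t ∈ Set.Ioo (P.eval (y i)) (P.eval (y (i + 1))) from
            ⟨by linarith [ht.1], by linarith [ht.2]⟩)
        exact ⟨r, fun _ => ⟨hr, hrt⟩⟩
      · rw [h] at h1
        rw [pow_succ, h] at h2
        obtain ⟨r, hr, hrt⟩ := intermediate_value_Ioo hle (f := fun x => P.eval x)
          P.continuous.continuousOn
          (show t ∈ Set.Ioo (P.eval (y (i + 1))) (P.eval (y i)) from
            ⟨by linarith [ht.1], by linarith [ht.2]⟩)
        exact ⟨r, fun _ => ⟨hr, hrt⟩⟩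
    · exact ⟨0, fun h => absurd h hi⟩
  choose r hr using hroot
  obtain ⟨q, hq, hqt⟩ := intermediate_value_Ioo hαβ.le (f := fun x => P.eval x)
    P.continuous.continuousOn
      (show t ∈ Set.Ioo (P.eval α) (P.eval β) from
        ⟨by linarith [ht.1], by linarith [ht.2]⟩)
  obtain ⟨w, hw⟩ : ∃ w : ℕ → ℝ, w = fun i => i.casesOn q r := ⟨_, rfl⟩
  have hw0 : w 0 = q := by subst hw; rfl
  have hws : ∀ i, w (i + 1) = r i := fun i => by subst hw; rfl
  have hwP : ∀ i < n, P.eval (w i) = t ∧ w i ∈ Set.Icc (-1 : ℝ) 1 ∪ Set.Icc α β := by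
    intro i hi
    cases i with
    | zero => rw [hw0]; exact ⟨hqt, Or.inr ⟨hq.1.le, hq.2.le⟩⟩
    | succ i =>
      rw [hws]
      obtain ⟨h1, h2⟩ := hr i hi
      exact ⟨h2, Or.inl ⟨(hyI (i + 1) hi).1.trans h1.1.le, h1.2.le.trans (hyI i (by omega)).2⟩⟩
  have hwanti : StrictAntiOn w (Set.Iio n) := by
    refine strictAntiOn_of_succ_lt Set.ordConnected_Iio fun i _ _ hi => ?_
    have hi : i + 1 < n := hi
    change w (i + 1) < w i
    rw [hws]
    cases i with
    | zero =>
      rw [hw0]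
      exact ((hr 0 hi).1.2.le.trans (hyI 0 (by omega)).2).trans_lt (hα.trans hq.1)
    | succ i =>
      rw [hws]
      exact (hr (i + 1) hi).1.2.trans (hr i (by omega)).1.1
  by_contra hcon
  have hzw : ∀ i < n, (w i : ℂ) ≠ z := fun i hi h => hcon ⟨w i, (hwP i hi).2, h⟩
  obtain ⟨v, hv⟩ : ∃ v : ℕ → ℂ, v = fun i => i.casesOn z fun j => (w j : ℂ) := ⟨_, rfl⟩
  have hv0 : v 0 = z := by subst hv; rfl
  have hvs : ∀ i, v (i + 1) = (w i : ℂ) := fun i => by subst hv; rfl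
  have hinj : Set.InjOn v (Finset.range (n + 1) : Set ℕ) := by
    intro i hi j hj hij
    have hi := Finset.mem_range.mp (Finset.mem_coe.mp hi)
    have hj := Finset.mem_range.mp (Finset.mem_coe.mp hj)
    cases i with
    | zero =>
      cases j with
      | zero => rfl
      | succ j => rw [hv0, hvs] at hij; exact absurd hij.symm (hzw j (by omega))
    | succ i =>
      cases j with
      | zero => rw [hv0, hvs] at hij; exact absurd hij (hzw i (by omega))
      | succ j =>
        rw [hvs, hvs] at hij
        rw [hwanti.injOn (Set.mem_Iio.mpr (by omega)) (Set.mem_Iio.mpr (by omega))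
          (Complex.ofReal_injective hij)]
  have hzero : P.map Complex.ofRealHom - C (t : ℂ) = 0 := by
    refine eq_zero_of_degree_lt_of_eval_index_eq_zero (Finset.range (n + 1)) hinj ?_ ?_
    · rw [Finset.card_range]
      refine degree_le_natDegree.trans_lt ?_
      rw [natDegree_sub_C, natDegree_map, hPd]
      exact_mod_cast Nat.lt_succ_self n
    · intro i hi
      have hi := Finset.mem_range.mp hi
      cases i with
      | zero => rw [hv0, eval_sub, hz, eval_C, sub_self]
      | succ i =>
        rw [hvs, eval_sub, eval_map_ofReal, (hwP i (by omega)).1, eval_C, sub_self]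
  have := congrArg natDegree hzero
  rw [natDegree_sub_C, natDegree_map, hPd, natDegree_zero] at this
  omega

theorem inverseImage_eq_of_endpoints {α β : ℝ} (hPd : P.natDegree = n) (hn : 1 ≤ n)
    (hLZ : L = maxAbs (P.map Complex.ofRealHom))
    (hPL : ∀ x ∈ Set.Icc (-1 : ℝ) 1, |P.eval x| ≤ L)
    (hyI : ∀ i < n, y i ∈ Set.Icc (-1 : ℝ) 1) (hy : ∀ i, i + 1 < n → y (i + 1) < y i)
    (hyL : ∀ i < n, P.eval (y i) = -((-1) ^ i * L)) (hα : 1 < α) (hαβ : α < β)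
    (hPα : P.eval α = -L) (hPβ : P.eval β = L) (hIcc : ∀ x ∈ Set.Icc α β, |P.eval x| ≤ L)
    (hpos : ∀ z : ℂ, (P.map Complex.ofRealHom).eval z = (L : ℂ) →
      ∃ x ∈ Set.Icc (-1 : ℝ) 1 ∪ Set.Icc α β, (x : ℂ) = z)
    (hneg : ∀ z : ℂ, (P.map Complex.ofRealHom).eval z = ((-L : ℝ) : ℂ) →
      ∃ x ∈ Set.Icc (-1 : ℝ) 1 ∪ Set.Icc α β, (x : ℂ) = z) :
    inverseImage (P.map Complex.ofRealHom) =
      (fun x : ℝ => (x : ℂ)) '' (Set.Icc (-1) 1 ∪ Set.Icc α β) := by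
  ext z
  rw [inverseImage, Set.mem_ofPred_eq, ← hLZ]
  constructor
  · rintro ⟨t, ht, hz⟩
    rcases ht.2.eq_or_lt with rfl | h2
    · exact hpos z hz
    rcases ht.1.eq_or_lt with rfl | h1
    · exact hneg z hz
    exact eq_ofReal_of_abs_lt hPd hn hyI hy hyL hα hαβ hPα hPβ ⟨h1, h2⟩ hz
  · rintro ⟨x, hx, rfl⟩
    refine ⟨P.eval x, ?_, eval_map_ofReal P x⟩
    rcases hx with hx | hx
    · exact abs_le.mp (hPL x hx)
    · exact abs_le.mp (hIcc x hx)

end Factorization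

end ZolotarevArcs

/-! ### The endpoints and the final equations -/

namespace ZolotarevArcs

open Polynomial

theorem nextCoeff_X_sub_C_mul (a : ℝ) {Q : ℝ[X]} (hQ : Q.Monic) :
    ((X - C a) * Q).nextCoeff = -a + Q.nextCoeff := by
  rw [(monic_X_sub_C a).nextCoeff_mul hQ, nextCoeff_X_sub_C]

theorem nextCoeff_add_C {n : ℕ} (hn : 2 ≤ n) {P : ℝ[X]} (hPd : P.natDegree = n) (c : ℝ) :
    (P + C c).nextCoeff = P.coeff (n - 1) := by
  rw [nextCoeff, natDegree_add_C, hPd, if_neg (by omega), coeff_add, coeff_C, if_neg (by omega),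
    add_zero]

theorem eval_map_eq_zero_of_eval_eq {P : ℝ[X]} {L c : ℝ} (hc : c = -L) {z : ℂ}
    (hz : (P.map Complex.ofRealHom).eval z = (L : ℂ)) :
    ((P + C c).map Complex.ofRealHom).eval z = 0 := by
  rw [Polynomial.map_add, eval_add, hz, map_C, eval_C, hc]
  simp

theorem RootsInIcc.X_sub_C {a : ℝ} (ha : a ∈ Set.Icc (-1 : ℝ) 1) : RootsInIcc (X - C a) := by
  intro z hz
  refine ⟨a, ha, ?_⟩
  simp only [Polynomial.map_sub, map_X, map_C, eval_sub, eval_X, eval_C] at hz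
  exact (sub_eq_zero.mp hz).symm

theorem RootsInIcc.mul {U V : ℝ[X]} (hU : RootsInIcc U) (hV : RootsInIcc V) :
    RootsInIcc (U * V) := by
  intro z hz
  rw [Polynomial.map_mul, eval_mul] at hz
  exact (mul_eq_zero.mp hz).elim (hU z) (hV z)

/-- The endpoints exist and give the inverse image as soon as `P ∓ L` has one zero `β`, resp. `α`,
outside `[-1, 1]`. -/
theorem endpoints_of_factorization {n : ℕ} (hn : 1 ≤ n) {P : ℝ[X]} (hPd : P.natDegree = n) {L : ℝ}
    (hL : 0 < L) (hLZ : L = maxAbs (P.map Complex.ofRealHom))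
    (hPL : ∀ x ∈ Set.Icc (-1 : ℝ) 1, |P.eval x| ≤ L) {y : ℕ → ℝ}
    (hyI : ∀ i < n, y i ∈ Set.Icc (-1 : ℝ) 1) (hy : ∀ i, i + 1 < n → y (i + 1) < y i)
    (hyL : ∀ i < n, P.eval (y i) = -((-1) ^ i * L)) (hder : P.derivative.eval 1 < 0)
    {α β : ℝ} (hβ : 1 < β) {A B : ℝ[X]} (hPA : P + C (-L) = (X - C β) * A)
    (hPB : P + C L = (X - C 1) * ((X - C α) * B)) (hA : RootsInIcc A) (hB : RootsInIcc B)
    (hA0 : ∀ x, 1 ≤ x → 0 ≤ A.eval x) (hB0 : ∀ x, 1 ≤ x → 0 ≤ B.eval x) :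
    1 < α ∧ α < β ∧ inverseImage (P.map Complex.ofRealHom) =
      (fun x : ℝ => (x : ℂ)) '' (Set.Icc (-1) 1 ∪ Set.Icc α β) := by
  have eA : ∀ x, P.eval x - L = (x - β) * A.eval x := fun x => by
    have := congrArg (fun p => p.eval x) hPA
    simpa [sub_eq_add_neg] using this
  have eB : ∀ x, P.eval x + L = (x - 1) * ((x - α) * B.eval x) := fun x => by
    have := congrArg (fun p => p.eval x) hPB
    simpa using this
  -- With `P'(1) < 0` and `B(1) ≥ 0` this forces `α > 1`.
  have hd1 : P.derivative.eval 1 = (1 - α) * B.eval 1 := by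
    have := congrArg (fun p => (derivative p).eval 1) hPB
    simpa using this
  have hα : 1 < α := by
    by_contra h
    have := mul_nonneg (sub_nonneg.mpr (not_lt.mp h)) (hB0 1 le_rfl)
    linarith
  have hPβ : P.eval β = L := by linarith [eA β, show (β - β) * A.eval β = 0 by ring]
  have hPα : P.eval α = -L := by
    linarith [eB α, show (α - 1) * ((α - α) * B.eval α) = 0 by ring]
  -- If `β ≤ α`, the factorization makes `P(β) + L` nonpositive, but it equals `2L`.
  have hαβ : α < β := by
    by_contra h
    have h1 := eB β
    have h2 := mul_nonneg (sub_pos.mpr hβ).le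
      (mul_nonneg (sub_nonneg.mpr (not_lt.mp h)) (hB0 β hβ.le))
    rw [hPβ] at h1
    nlinarith
  have hmem : ∀ {z : ℂ} {U : ℝ[X]}, RootsInIcc U → (U.map Complex.ofRealHom).eval z = 0 →
      ∃ x ∈ Set.Icc (-1 : ℝ) 1 ∪ Set.Icc α β, (x : ℂ) = z := fun hU hz =>
    let ⟨x, hx, hxz⟩ := hU _ hz
    ⟨x, Or.inl hx, hxz⟩
  refine ⟨hα, hαβ, inverseImage_eq_of_endpoints hPd hn hLZ hPL hyI hy hyL hα hαβ hPα hPβ ?_ ?_ ?_⟩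
  · intro x hx
    have h1 : 1 ≤ x := hα.le.trans hx.1
    refine abs_le.mpr ⟨?_, ?_⟩
    · have := mul_nonneg (sub_nonneg.mpr h1) (mul_nonneg (sub_nonneg.mpr hx.1) (hB0 x h1))
      linarith [eB x]
    · have := mul_nonneg (sub_nonneg.mpr hx.2) (hA0 x h1)
      nlinarith [eA x]
  · intro z hz
    have h := eval_map_eq_zero_of_eval_eq rfl hz
    rw [hPA, Polynomial.map_mul, eval_mul] at h
    rcases mul_eq_zero.mp h with h | h
    · refine ⟨β, Or.inr ⟨hαβ.le, le_rfl⟩, ?_⟩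
      simp only [Polynomial.map_sub, map_X, map_C, eval_sub, eval_X, eval_C] at h
      exact (sub_eq_zero.mp h).symm
    · exact hmem hA h
  · intro z hz
    have h := eval_map_eq_zero_of_eval_eq (neg_neg L).symm hz
    rw [hPB, Polynomial.map_mul, eval_mul, Polynomial.map_mul, eval_mul] at h
    rcases mul_eq_zero.mp h with h | h
    · exact hmem (RootsInIcc.X_sub_C (by norm_num)) h
    rcases mul_eq_zero.mp h with h | h
    · refine ⟨α, Or.inr ⟨le_rfl, hαβ.le⟩, ?_⟩
      simp only [Polynomial.map_sub, map_X, map_C, eval_sub, eval_X, eval_C] at h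
      exact (sub_eq_zero.mp h).symm
    · exact hmem hB h

end ZolotarevArcs

theorem corollary3 (n : ℕ) (hn : 2 ≤ n) (σ : ℝ)
    (hσ : Real.tan (Real.pi / (2 * (n : ℝ))) ^ 2 < σ)
    (Z : Polynomial ℂ) (hZ : ZolotarevArcs.IsZolotarev n σ Z) :
    ∃ α β : ℝ, 1 < α ∧ α < β ∧
      ZolotarevArcs.inverseImage Z =
        (fun x : ℝ => (x : ℂ)) '' (Set.Icc (-1) 1 ∪ Set.Icc α β) ∧
      (∀ m : ℕ, n = 2 * m + 1 →
        ZolotarevArcs.detPoly (ZolotarevArcs.sOdd₁ α β) ((m : ℤ) - 1) (m + 1) β = 0 ∧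
        -2 * ZolotarevArcs.detFi (ZolotarevArcs.sOdd₂ α β) ((m : ℤ) + 1) (m - 1) 1 +
          (α - (n : ℝ) * σ) *
            ZolotarevArcs.detF (ZolotarevArcs.sOdd₂ α β) ((m : ℤ) + 1) (m - 1) = 0) ∧
      (∀ m : ℕ, n = 2 * m + 2 →
        ZolotarevArcs.detPoly (ZolotarevArcs.sEven₁ α β) (m : ℤ) (m + 1) α = 0 ∧
        -2 * ZolotarevArcs.detFi (ZolotarevArcs.sEven₂ α β) ((m : ℤ) + 1) m 1 +
          (α + 1 - (n : ℝ) * σ) *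
            ZolotarevArcs.detF (ZolotarevArcs.sEven₂ α β) ((m : ℤ) + 1) m = 0) := by
  open ZolotarevArcs Polynomial in
  obtain ⟨P, rfl, hP, hPd, hPc, hPL, hL, y, hyI, hy, hy0, hya⟩ := hZ.exists_real_alternation hn
  obtain ⟨L, hLZ⟩ : ∃ L, L = maxAbs (P.map Complex.ofRealHom) := ⟨_, rfl⟩
  rw [← hLZ] at hPL hL hy0
  obtain ⟨hyL, hone, hlast, hcrit, hder⟩ :=
    alternation_endpoints hn hσ hP hPd hPc hL hPL hyI hy hy0 hya
  have hP1 : P.eval 1 < L := by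
    rw [← hone, hyL 0 (by omega)]
    simp only [pow_zero, one_mul]
    linarith
  obtain ⟨β, hβ, hPβ⟩ := exists_gt_eval_eq hP (by omega) hP1
  rcases Nat.even_or_odd' n with ⟨k, hk | hk⟩
  · obtain ⟨m, hm⟩ : ∃ m, n = 2 * m + 2 := ⟨k - 1, by omega⟩
    obtain ⟨α, U, V, hU, hV, hUd, hVd, hUr, hVr, hPA, hPB⟩ :=
      even_factorization hm hP hPd hyI hy hyL hone hlast hcrit hβ hPβ
    obtain ⟨hα, hαβ, himg⟩ := endpoints_of_factorization (by omega) hPd hL hLZ hPL hyI hy hyL hder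
      hβ hPA hPB ((RootsInIcc.X_sub_C (by norm_num)).mul (sq U ▸ hUr.mul hUr))
      (sq V ▸ hVr.mul hVr)
      (fun x hx => by
        simp only [eval_mul, eval_sub, eval_X, eval_C, eval_pow]
        exact mul_nonneg (by linarith) (sq_nonneg _))
      (fun x _ => by rw [eval_pow]; exact sq_nonneg _)
    refine ⟨α, β, hα, hαβ, himg, fun m' hm' => by omega, fun m' hm' => ?_⟩
    obtain rfl : m' = m := by omega
    obtain ⟨h1, h2⟩ := even_determinant_identities m' α β (2 * L) U V hU hV hUd hVd (by
      rw [← hPA, ← hPB, C_neg, two_mul, C_add]; ring)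
    have hV2 := hV.pow 2
    -- The subleading coefficients give `-nσ = -1 - α + 2v`, where `v` is that of `V`.
    have hnext := congrArg nextCoeff hPB
    rw [nextCoeff_add_C hn hPd, hPc, nextCoeff_X_sub_C_mul _ ((monic_X_sub_C _).mul hV2),
      nextCoeff_X_sub_C_mul _ hV2, hV.nextCoeff_pow, nsmul_eq_mul] at hnext
    refine ⟨h1, ?_⟩
    rw [h2]
    push_cast at hnext ⊢
    linear_combination (detF (sEven₂ α β) ((m' : ℤ) + 1) m') * hnext
  · obtain ⟨m, hm⟩ : ∃ m, n = 2 * m + 3 := ⟨k - 1, by omega⟩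
    obtain ⟨α, U, V, hU, hV, hUd, hVd, hUr, hVr, hPA, hPB⟩ :=
      odd_factorization hm hP hPd hyI hy hyL hone hlast hcrit hβ hPβ
    obtain ⟨hα, hαβ, himg⟩ := endpoints_of_factorization (by omega) hPd hL hLZ hPL hyI hy hyL hder
      hβ hPA (α := α) (B := (X - C (-1)) * V ^ 2) (by rw [hPB]; ring) (sq U ▸ hUr.mul hUr)
      ((RootsInIcc.X_sub_C (by norm_num)).mul (sq V ▸ hVr.mul hVr))
      (fun x _ => by rw [eval_pow]; exact sq_nonneg _)
      (fun x hx => by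
        simp only [eval_mul, eval_sub, eval_X, eval_C, eval_pow]
        exact mul_nonneg (by linarith) (sq_nonneg _))
    refine ⟨α, β, hα, hαβ, himg, fun m' hm' => ?_, fun m' hm' => by omega⟩
    -- The `m` of the statement is one more than that of the factorization, as `n = 2m + 3` here.
    obtain rfl : m' = m + 1 := by omega
    obtain ⟨h1, h2⟩ := odd_determinant_identities m α β (2 * L) U V hU hV hUd hVd (by
      rw [← hPA, ← hPB, C_neg, two_mul, C_add]; ring)
    have hV2 := hV.pow 2
    have hnext := congrArg nextCoeff hPB
    rw [nextCoeff_add_C hn hPd, hPc,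
      nextCoeff_X_sub_C_mul _ ((monic_X_sub_C _).mul ((monic_X_sub_C _).mul hV2)),
      nextCoeff_X_sub_C_mul _ ((monic_X_sub_C _).mul hV2),
      nextCoeff_X_sub_C_mul _ hV2, hV.nextCoeff_pow, nsmul_eq_mul] at hnext
    have e1 : ((m + 1 : ℕ) : ℤ) - 1 = (m : ℤ) := by push_cast; ring
    have e2 : ((m + 1 : ℕ) : ℤ) + 1 = (m : ℤ) + 2 := by push_cast; ring
    rw [e1, e2, Nat.add_sub_cancel]
    refine ⟨h1, ?_⟩
    rw [h2]
    push_cast at hnext ⊢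
    linear_combination (detF (sOdd₂ α β) ((m : ℤ) + 2) m) * hnext
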